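/- Let $q\in\mathbb C$ be nonzero and not a root of unity, and fix a logarithm $\ln q$, i.e. a complex number with $e^{\ln q}=q$. Let $U=U_q(\mathfrak{sl}_2)$ be the unital associative $\mathbb C$-algebra generated by $E,F,K,K^{-1}$ with relations $KK^{-1}=K^{-1}K=1$, $KE=q^2EK$, $KF=q^{-2}FK$, $EF-FE=\frac{K-K^{-1}}{q-q^{-1}}$. It is a Hopf algebra with coproduct the algebra homomorphism given by $\triangle(K^{\pm1})=K^{\pm1}\otimes K^{\pm1}$, $\triangle(E)=E\otimes K+1\otimes E$, $\triangle(F)=F\otimes1+K^{-1}\otimes F$ and antipode the anti-automorphism given by $S(K^{\pm1})=K^{\mp1}$, $S(E)=-EK^{-1}$, $S(F)=-KF$. The quantum adjoint action is $ad_u(a)=u\triangleright a=\sum u_{(1)}\,a\,S(u_{(2)})$, where $\triangle(u)=\sum u_{(1)}\otimes u_{(2)}$. For $m\ge 0$ let $V_m$ be the irreducible $U$-module with basis $v_0,\dots,v_m$ and $Kv_i=q^{m-2i}v_i$, $Fv_i=v_{i+1}$ (with $v_{m+1}=0$), $Ev_i=[i]_q[m+1-i]_q\,v_{i-1}$ (so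 $Ev_0=0$), where $[n]_q=\frac{q^n-q^{-n}}{q-q^{-1}}$; put $[n]_q!=[n]_q\cdots[1]_q$, $[0]_q!=1$. Let $\widehat U=\prod_{m\ge0}\mathrm{End}(V_m)$ be the completion of $U$, with the canonical map $\iota:U\to\widehat U$, and let the completed tensor square and cube of $U$ be $\prod_{m,n}\mathrm{End}(V_m)\otimes\mathrm{End}(V_n)$ and $\prod_{m,n,k}\mathrm{End}(V_m)\otimes\mathrm{End}(V_n)\otimes\mathrm{End}(V_k)$; the antipode and the adjoint action extend to $\widehat U$ componentwise. $\widehat U$ contains the element $H$ with $Hv_i=(m-2i)v_i$ on $V_m$ (so $q^H=K$), for which $\triangle(H)=H\otimes1+1\otimes H$ and $S(H)=-H$. Let $$R=\sum R_1\otimes R_2=q^{\frac12H\otimes H}\sum_{n=0}^\infty q^{\frac{n(n+1)}2}\frac{(1-q^{-2})^n}{[n]_q!}\,E^n\otimes F^n,\qquad q^{\frac12H\otimes H}=\exp\!\big(\tfrac{\ln q}{2}\,H\otimes H\big),$$ and define the braided coproduct, the braided antipode and the braiding by $$\underline\triangle(a)=\sum a_{(1)}S(R_2)\otimes R_1\triangleright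 a_{(2)},\qquad \underline S(a)=\sum R_2\,S(R_1\triangleright a),\qquad \hat R(a\otimes b)=\sum R_2\triangleright b\otimes R_1\triangleright a,$$ all with values in the completions. The braided adjoint action of $u\in U$ on $X\in U$ is $$\underline{ad}_u(X)=\cdot^2\circ(\mathrm{Id}\otimes\hat R)\circ(\mathrm{Id}\otimes\underline S\otimes\mathrm{Id})\circ(\underline\triangle\otimes\mathrm{Id})(u\otimes X)\in\widehat U,\qquad \cdot^2(x\otimes y\otimes z)=xyz.$$ Then $\iota$ is injective, so that $U$ is a subalgebra of $\widehat U$, and the braided adjoint action of $U$ on itself coincides with the quantum adjoint action: $\underline{ad}_u(X)=ad_u(X)$ for all $u,X\in U$. Explicitly, for all $X\in U$, $$\underline{ad}_E(X)=(EX-XE)K^{-1},\quad \underline{ad}_K(X)=KXK^{-1},\quad \underline{ad}_{K^{-1}}(X)=K^{-1}XK,\quad \underline{ad}_F(X)=FX-K^{-1}XKF.$$ -/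

import Mathlib

open scoped TensorProduct

namespace QuantumSL2

noncomputable section

/-! ### The quantized enveloping algebra of sl₂ and its Hopf structure -/

/-- The generators of `U_q(sl₂)`. -/
inductive Gen : Type
  | E | F | K | Kinv

/-- The defining relations of `U_q(sl₂)`. -/
inductive Rel (q : ℂˣ) : FreeAlgebra ℂ Gen → FreeAlgebra ℂ Gen → Prop
  | K_Kinv : Rel q (FreeAlgebra.ι ℂ Gen.K * FreeAlgebra.ι ℂ Gen.Kinv) 1
  | Kinv_K : Rel q (FreeAlgebra.ι ℂ Gen.Kinv * FreeAlgebra.ι ℂ Gen.K) 1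
  | K_E : Rel q (FreeAlgebra.ι ℂ Gen.K * FreeAlgebra.ι ℂ Gen.E)
      ((q : ℂ) ^ 2 • (FreeAlgebra.ι ℂ Gen.E * FreeAlgebra.ι ℂ Gen.K))
  | K_F : Rel q (FreeAlgebra.ι ℂ Gen.K * FreeAlgebra.ι ℂ Gen.F)
      ((q : ℂ) ^ (-2 : ℤ) • (FreeAlgebra.ι ℂ Gen.F * FreeAlgebra.ι ℂ Gen.K))
  | E_F : Rel q (FreeAlgebra.ι ℂ Gen.E * FreeAlgebra.ι ℂ Gen.F
        - FreeAlgebra.ι ℂ Gen.F * FreeAlgebra.ι ℂ Gen.E)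
      (((q : ℂ) - (q : ℂ)⁻¹)⁻¹ • (FreeAlgebra.ι ℂ Gen.K - FreeAlgebra.ι ℂ Gen.Kinv))

/-- The complex unital associative algebra `U_q(sl₂)`. -/
def Uq (q : ℂˣ) : Type := RingQuot (Rel q)

instance (q : ℂˣ) : Ring (Uq q) := inferInstanceAs (Ring (RingQuot (Rel q)))

instance (q : ℂˣ) : Algebra ℂ (Uq q) := inferInstanceAs (Algebra ℂ (RingQuot (Rel q)))

/-- The quotient map from the free algebra. -/
def mk (q : ℂˣ) : FreeAlgebra ℂ Gen →ₐ[ℂ] Uq q := RingQuot.mkAlgHom ℂ (Rel q)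

theorem mk_rel (q : ℂˣ) {x y : FreeAlgebra ℂ Gen} (h : Rel q x y) : mk q x = mk q y :=
  RingQuot.mkAlgHom_rel ℂ h

theorem mk_surjective (q : ℂˣ) : Function.Surjective (mk q) :=
  RingQuot.mkAlgHom_surjective ℂ (Rel q)

/-- The image of a generator in `U_q(sl₂)`. -/
def gen (q : ℂˣ) (x : Gen) : Uq q := mk q (FreeAlgebra.ι ℂ x)

/-- The generator `E`. -/
abbrev E (q : ℂˣ) : Uq q := gen q Gen.E
/-- The generator `F`. -/
abbrev F (q : ℂˣ) : Uq q := gen q Gen.F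
/-- The generator `K`. -/
abbrev K (q : ℂˣ) : Uq q := gen q Gen.K
/-- The generator `K⁻¹`. -/
abbrev Kinv (q : ℂˣ) : Uq q := gen q Gen.Kinv

theorem K_mul_Kinv (q : ℂˣ) : K q * Kinv q = 1 := by
  simpa [gen] using mk_rel q (Rel.K_Kinv (q := q))

theorem Kinv_mul_K (q : ℂˣ) : Kinv q * K q = 1 := by
  simpa [gen] using mk_rel q (Rel.Kinv_K (q := q))

theorem K_mul_E (q : ℂˣ) : K q * E q = (q : ℂ) ^ 2 • (E q * K q) := by
  simpa only [gen, map_mul, map_smul] using mk_rel q (Rel.K_E (q := q))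

theorem K_mul_F (q : ℂˣ) : K q * F q = (q : ℂ) ^ (-2 : ℤ) • (F q * K q) := by
  simpa only [gen, map_mul, map_smul] using mk_rel q (Rel.K_F (q := q))

theorem E_mul_F_sub (q : ℂˣ) : E q * F q - F q * E q
    = ((q : ℂ) - (q : ℂ)⁻¹)⁻¹ • (K q - Kinv q) := by
  simpa only [gen, map_mul, map_smul, map_sub] using
    mk_rel q (Rel.E_F (q := q))

/-- The universal property: four elements of an algebra that satisfy the defining relations
give an algebra homomorphism from `U_q(sl₂)`. -/
def liftGen (q : ℂˣ) {A : Type*} [Ring A] [Algebra ℂ A] (g : Gen → A)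
    (h₁ : g Gen.K * g Gen.Kinv = 1) (h₂ : g Gen.Kinv * g Gen.K = 1)
    (h₃ : g Gen.K * g Gen.E = (q : ℂ) ^ 2 • (g Gen.E * g Gen.K))
    (h₄ : g Gen.K * g Gen.F = (q : ℂ) ^ (-2 : ℤ) • (g Gen.F * g Gen.K))
    (h₅ : g Gen.E * g Gen.F - g Gen.F * g Gen.E
      = ((q : ℂ) - (q : ℂ)⁻¹)⁻¹ • (g Gen.K - g Gen.Kinv)) : Uq q →ₐ[ℂ] A :=
  RingQuot.liftAlgHom ℂ ⟨FreeAlgebra.lift ℂ g, by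
    intro x y hxy
    cases hxy <;> simpa⟩

theorem liftGen_gen (q : ℂˣ) {A : Type*} [Ring A] [Algebra ℂ A] (g : Gen → A)
    (h₁ h₂ h₃ h₄ h₅) (x : Gen) : liftGen q g h₁ h₂ h₃ h₄ h₅ (gen q x) = g x := by
  exact (RingQuot.liftAlgHom_mkAlgHom_apply ℂ (FreeAlgebra.lift ℂ g) _ _).trans (by simp)

theorem E_mul_Kinv (q : ℂˣ) : E q * Kinv q = (q : ℂ) ^ 2 • (Kinv q * E q) := by
  have h : Kinv q * (K q * E q) * Kinv q = Kinv q * ((q : ℂ) ^ 2 • (E q * K q)) * Kinv q := by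
    rw [K_mul_E]
  rw [← mul_assoc, Kinv_mul_K, one_mul, mul_smul_comm, smul_mul_assoc, mul_assoc, mul_assoc,
    K_mul_Kinv, mul_one] at h
  exact h

theorem F_mul_Kinv (q : ℂˣ) : F q * Kinv q = (q : ℂ) ^ (-2 : ℤ) • (Kinv q * F q) := by
  have h : Kinv q * (K q * F q) * Kinv q
      = Kinv q * ((q : ℂ) ^ (-2 : ℤ) • (F q * K q)) * Kinv q := by
    rw [K_mul_F]
  rw [← mul_assoc, Kinv_mul_K, one_mul, mul_smul_comm, smul_mul_assoc, mul_assoc, mul_assoc,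
    K_mul_Kinv, mul_one] at h
  exact h

theorem sq_mul_zpow (q : ℂˣ) : (q : ℂ) ^ 2 * (q : ℂ) ^ (-2 : ℤ) = 1 := by
  have := q.ne_zero
  rw [zpow_neg]
  exact mul_inv_cancel₀ (by positivity)

/-- The values of the coproduct on the generators. -/
def comulGen (q : ℂˣ) : Gen → Uq q ⊗[ℂ] Uq q
  | Gen.E => E q ⊗ₜ K q + 1 ⊗ₜ E q
  | Gen.F => F q ⊗ₜ 1 + Kinv q ⊗ₜ F q
  | Gen.K => K q ⊗ₜ K q
  | Gen.Kinv => Kinv q ⊗ₜ Kinv q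

/-- The coproduct, as an algebra homomorphism. -/
def comul (q : ℂˣ) : Uq q →ₐ[ℂ] Uq q ⊗[ℂ] Uq q :=
  liftGen q (comulGen q)
    (by simp [comulGen, K_mul_Kinv, Algebra.TensorProduct.one_def])
    (by simp [comulGen, Kinv_mul_K, Algebra.TensorProduct.one_def])
    (by
      simp only [comulGen, mul_add, add_mul, Algebra.TensorProduct.tmul_mul_tmul, K_mul_E,
        one_mul, mul_one, smul_add, TensorProduct.smul_tmul', TensorProduct.tmul_smul])
    (by
      have h : K q * Kinv q = Kinv q * K q := by rw [K_mul_Kinv, Kinv_mul_K]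
      simp only [comulGen, mul_add, add_mul, Algebra.TensorProduct.tmul_mul_tmul, K_mul_F, h,
        one_mul, mul_one, smul_add, TensorProduct.smul_tmul', TensorProduct.tmul_smul])
    (by
      have h : (E q * Kinv q) ⊗ₜ[ℂ] (K q * F q) = (Kinv q * E q) ⊗ₜ[ℂ] (F q * K q) := by
        rw [E_mul_Kinv, K_mul_F, TensorProduct.smul_tmul_smul, sq_mul_zpow, one_smul]
      have h₁ : E q * F q = F q * E q + ((q : ℂ) - (q : ℂ)⁻¹)⁻¹ • (K q - Kinv q) := by
        rw [← E_mul_F_sub]; abel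
      simp only [comulGen, mul_add, add_mul, Algebra.TensorProduct.tmul_mul_tmul,
        one_mul, mul_one, h, h₁, TensorProduct.add_tmul, TensorProduct.tmul_add,
        TensorProduct.sub_tmul, TensorProduct.tmul_sub, smul_sub, ← TensorProduct.smul_tmul',
        TensorProduct.tmul_smul]
      abel)

/-- The values of the antipode on the generators. -/
def antipodeGen (q : ℂˣ) : Gen → Uq q
  | Gen.E => -(E q * Kinv q)
  | Gen.F => -(K q * F q)
  | Gen.K => Kinv q
  | Gen.Kinv => K q

/-- The antipode, as an algebra homomorphism to the opposite algebra. -/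
def antipodeHom (q : ℂˣ) : Uq q →ₐ[ℂ] (Uq q)ᵐᵒᵖ :=
  liftGen q (fun x => MulOpposite.op (antipodeGen q x))
    (by
      apply MulOpposite.unop_injective
      simp [antipodeGen, K_mul_Kinv])
    (by
      apply MulOpposite.unop_injective
      simp [antipodeGen, Kinv_mul_K])
    (by
      apply MulOpposite.unop_injective
      simp only [antipodeGen, MulOpposite.unop_mul, MulOpposite.unop_op, MulOpposite.unop_smul]
      rw [neg_mul, mul_neg, E_mul_Kinv, smul_mul_assoc, ← smul_neg, mul_smul_comm, mul_assoc,
        E_mul_Kinv, mul_smul_comm])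
    (by
      apply MulOpposite.unop_injective
      simp only [antipodeGen, MulOpposite.unop_mul, MulOpposite.unop_op, MulOpposite.unop_smul]
      rw [neg_mul, mul_neg, mul_assoc, F_mul_Kinv, mul_smul_comm, smul_neg, ← mul_assoc,
        ← mul_assoc, K_mul_Kinv, Kinv_mul_K])
    (by
      apply MulOpposite.unop_injective
      simp only [antipodeGen, MulOpposite.unop_mul, MulOpposite.unop_op, MulOpposite.unop_smul,
        MulOpposite.unop_sub, neg_mul_neg]
      have h₁ : K q * F q * (E q * Kinv q) = F q * E q := by
        rw [E_mul_Kinv, K_mul_F, smul_mul_smul_comm, mul_comm, sq_mul_zpow, one_smul,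
          mul_assoc, ← mul_assoc (K q), K_mul_Kinv, one_mul]
      have h₂ : E q * Kinv q * (K q * F q) = E q * F q := by
        rw [mul_assoc, ← mul_assoc (Kinv q), Kinv_mul_K, one_mul]
      rw [h₁, h₂, ← neg_sub, E_mul_F_sub, ← smul_neg, neg_sub])

/-- The antipode `S`, an anti-automorphism of `U_q(sl₂)`, as a linear map. -/
def antipode (q : ℂˣ) : Uq q →ₗ[ℂ] Uq q :=
  (MulOpposite.opLinearEquiv ℂ).symm.toLinearMap ∘ₗ (antipodeHom q).toLinearMap

theorem antipode_gen (q : ℂˣ) (x : Gen) : antipode q (gen q x) = antipodeGen q x := by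
  simp [antipode, antipodeHom, liftGen_gen]

theorem antipode_one (q : ℂˣ) : antipode q 1 = 1 := by
  simp [antipode]

theorem antipode_mul (q : ℂˣ) (u v : Uq q) :
    antipode q (u * v) = antipode q v * antipode q u := by
  simp [antipode]

/-- The linear map `x ⊗ y ↦ (a ↦ x a y)`. -/
def sandwich (A : Type*) [Ring A] [Algebra ℂ A] : A ⊗[ℂ] A →ₗ[ℂ] Module.End ℂ A :=
  TensorProduct.lift (LinearMap.mk₂ ℂ
    (fun x y : A => LinearMap.mulLeft ℂ x ∘ₗ LinearMap.mulRight ℂ y)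
    (fun _ _ _ => by ext; simp [add_mul]) (fun _ _ _ => by ext; simp)
    (fun _ _ _ => by ext; simp [mul_add]) (fun _ _ _ => by ext; simp))

/-- The (ordinary) quantum adjoint action `ad_u(a) = ∑ u₍₁₎ a S(u₍₂₎)` on `U_q(sl₂)`. -/
def ad (q : ℂˣ) (u : Uq q) : Module.End ℂ (Uq q) :=
  sandwich (Uq q) (TensorProduct.map LinearMap.id (antipode q) (comul q u))

/-! ### The finite-dimensional representations and the completion

The completion of `U_q(sl₂)` is the product over `m` of the endomorphism algebras of the
irreducible representations `V_m` of type 1 (highest weight `q ^ m`, dimension `m + 1`), and the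
completed tensor powers are the products of the tensor products of these endomorphism algebras.
Convergence in these products is convergence of each component. -/

/-- The `q`-number `[n]_q`. -/
def qNum (q : ℂˣ) (n : ℕ) : ℂ :=
  ((q : ℂ) ^ n - (q : ℂ)⁻¹ ^ n) / ((q : ℂ) - (q : ℂ)⁻¹)

/-- The `q`-factorial `[n]_q!`. -/
def qFactorial (q : ℂˣ) (n : ℕ) : ℂ := ∏ i ∈ Finset.range n, qNum q (i + 1)

/-- The endomorphism algebra of `V_m` in a basis `v_0, …, v_m` of weight vectors. -/
abbrev EndV (m : ℕ) : Type := Matrix (Fin (m + 1)) (Fin (m + 1)) ℂ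

/-- The weight `m - 2 i` of the basis vector `v_i` of `V_m`. -/
def wt (m : ℕ) (i : Fin (m + 1)) : ℤ := (m : ℤ) - 2 * (i : ℕ)

/-- The action of the generators on `V_m`: `K v_i = q ^ (m - 2 i) v_i`, `F v_i = v_{i+1}` and
`E v_i = [i] [m + 1 - i] v_{i-1}`. -/
def repGen (q : ℂˣ) (m : ℕ) : Gen → EndV m
  | Gen.E => Matrix.of fun j i =>
      if (j : ℕ) + 1 = i then qNum q i * qNum q (m + 1 - i) else 0
  | Gen.F => Matrix.of fun j i => if (j : ℕ) = i + 1 then 1 else 0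
  | Gen.K => Matrix.diagonal fun i => (q : ℂ) ^ wt m i
  | Gen.Kinv => Matrix.diagonal fun i => (q : ℂ) ^ (-wt m i)

theorem repGen_E_mul_F (q : ℂˣ) (m : ℕ) : repGen q m Gen.E * repGen q m Gen.F
    = Matrix.diagonal fun i : Fin (m + 1) => qNum q (i + 1) * qNum q (m - i) := by
  ext j i
  rw [Matrix.mul_apply, Matrix.diagonal_apply]
  by_cases hi : (i : ℕ) < m
  · rw [Finset.sum_eq_single (⟨i + 1, by omega⟩ : Fin (m + 1))]
    · by_cases h : j = i
      · subst h; simp [repGen]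
      · have h' : (j : ℕ) ≠ i := fun e => h (Fin.ext e)
        simp [repGen, h, h']
    · intro k _ hk
      have h' : (k : ℕ) ≠ i + 1 := fun e => hk (Fin.ext e)
      simp [repGen, h']
    · simp
  · have him : (i : ℕ) = m := by omega
    rw [Finset.sum_eq_zero]
    · have h0 : qNum q (m - (i : ℕ)) = 0 := by simp [him, qNum]
      split_ifs with h
      · subst h; simp [h0]
      · rfl
    · intro k _
      have h' : (k : ℕ) ≠ i + 1 := by omega
      simp [repGen, h']

theorem repGen_F_mul_E (q : ℂˣ) (m : ℕ) : repGen q m Gen.F * repGen q m Gen.E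
    = Matrix.diagonal fun i : Fin (m + 1) => qNum q i * qNum q (m + 1 - i) := by
  ext j i
  rw [Matrix.mul_apply, Matrix.diagonal_apply]
  by_cases hi : (i : ℕ) = 0
  · rw [Finset.sum_eq_zero]
    · have h0 : qNum q (i : ℕ) = 0 := by simp [hi, qNum]
      split_ifs with h
      · subst h; simp [h0]
      · rfl
    · intro k _
      have h' : (k : ℕ) + 1 ≠ i := by omega
      simp [repGen, h']
  · rw [Finset.sum_eq_single (⟨i - 1, by omega⟩ : Fin (m + 1))]
    · have e : (i : ℕ) - 1 + 1 = i := by omega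
      by_cases h : j = i
      · subst h; simp [repGen, e]
      · have h' : (j : ℕ) ≠ i := fun e => h (Fin.ext e)
        simp [repGen, h, h', e]
    · intro k _ hk
      have h' : (k : ℕ) + 1 ≠ i := fun e => hk (Fin.ext (by simp; omega))
      simp [repGen, h']
    · simp

theorem qNum_identity (q : ℂˣ) (a b : ℕ) :
    qNum q (a + 1) * qNum q b - qNum q a * qNum q (b + 1)
      = ((q : ℂ) - (q : ℂ)⁻¹)⁻¹ * ((q : ℂ) ^ ((b : ℤ) - a) - (q : ℂ) ^ (-((b : ℤ) - a))) := by
  have hq := q.ne_zero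
  by_cases hd : (q : ℂ) - (q : ℂ)⁻¹ = 0
  · simp [qNum, hd]
  · have h : ((q : ℂ) ^ (a + 1) - (q : ℂ)⁻¹ ^ (a + 1)) * ((q : ℂ) ^ b - (q : ℂ)⁻¹ ^ b)
        - ((q : ℂ) ^ a - (q : ℂ)⁻¹ ^ a) * ((q : ℂ) ^ (b + 1) - (q : ℂ)⁻¹ ^ (b + 1))
        = ((q : ℂ) - (q : ℂ)⁻¹) *
          ((q : ℂ) ^ b * (q : ℂ)⁻¹ ^ a - (q : ℂ) ^ a * (q : ℂ)⁻¹ ^ b) := by ring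
    rw [neg_sub, zpow_sub₀ hq, zpow_sub₀ hq, zpow_natCast, zpow_natCast, qNum, qNum, qNum, qNum,
      div_mul_div_comm, div_mul_div_comm, ← sub_div, h, mul_div_mul_left _ _ hd, inv_pow,
      inv_pow, div_eq_inv_mul, div_eq_mul_inv, div_eq_mul_inv]

/-- The irreducible representation `V_m` of type 1, as an algebra homomorphism. -/
def rep (q : ℂˣ) (m : ℕ) : Uq q →ₐ[ℂ] EndV m :=
  liftGen q (repGen q m)
    (by
      have := q.ne_zero
      simp only [repGen, Matrix.diagonal_mul_diagonal, ← zpow_add₀ this]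
      simp)
    (by
      have := q.ne_zero
      simp only [repGen, Matrix.diagonal_mul_diagonal, ← zpow_add₀ this]
      simp)
    (by
      have := q.ne_zero
      ext j i
      simp only [repGen, Matrix.diagonal_mul, Matrix.mul_diagonal, Matrix.smul_apply,
        Matrix.of_apply, smul_eq_mul]
      split_ifs with h
      · have : wt m j = 2 + wt m i := by simp only [wt]; omega
        rw [this, zpow_add₀ q.ne_zero, show (q : ℂ) ^ (2 : ℤ) = (q : ℂ) ^ 2 from by norm_cast]
        ring
      · simp)
    (by
      ext j i
      simp only [repGen, Matrix.diagonal_mul, Matrix.mul_diagonal, Matrix.smul_apply,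
        Matrix.of_apply, smul_eq_mul]
      split_ifs with h
      · have : wt m j = -2 + wt m i := by simp only [wt]; omega
        rw [this, zpow_add₀ q.ne_zero]
        ring
      · simp)
    (by
      rw [repGen_E_mul_F, repGen_F_mul_E]
      simp only [repGen, Matrix.diagonal_sub, ← Matrix.diagonal_smul]
      congr 1
      ext i
      have h₁ : m + 1 - (i : ℕ) = (m - i) + 1 := by omega
      have h₂ : wt m i = ((m - i : ℕ) : ℤ) - (i : ℕ) := by simp only [wt]; omega
      rw [h₁, qNum_identity, ← h₂]
      simp)

/-- The scalars that describe the antipode on `End V_m`. -/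
def antipodeScalar (q : ℂˣ) (m : ℕ) (i : Fin (m + 1)) : ℂ :=
  (-1) ^ (i : ℕ) * (q : ℂ) ^ ((i : ℤ) * ((m : ℤ) - 1 - i))

theorem antipodeScalar_ne_zero (q : ℂˣ) (m : ℕ) (i : Fin (m + 1)) :
    antipodeScalar q m i ≠ 0 := by
  have := q.ne_zero
  simp [antipodeScalar, zpow_ne_zero]

/-- The antipode on `End V_m`: the anti-automorphism through which the antipode of `U_q(sl₂)`
acts on `End V_m`, that is, the one with `S (ρ u) = ρ (S u)` for the representation `ρ` on `V_m`
(see `antipodeV_rep`); in matrix form, `S A = C Aᵀ C⁻¹` with an antidiagonal matrix `C`. -/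
def antipodeV (q : ℂˣ) (m : ℕ) : EndV m →ₗ[ℂ] EndV m where
  toFun A := Matrix.of fun i j =>
    antipodeScalar q m i * (antipodeScalar q m j)⁻¹ * A (Fin.rev j) (Fin.rev i)
  map_add' A B := by ext; simp [mul_add]
  map_smul' c A := by ext; simp; ring

theorem antipodeV_mul (q : ℂˣ) (m : ℕ) (A B : EndV m) :
    antipodeV q m (A * B) = antipodeV q m B * antipodeV q m A := by
  ext i j
  simp only [antipodeV, LinearMap.coe_mk, AddHom.coe_mk, Matrix.of_apply, Matrix.mul_apply,
    Finset.mul_sum]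
  rw [← Equiv.sum_comp Fin.revPerm]
  refine Finset.sum_congr rfl fun k _ => ?_
  have := antipodeScalar_ne_zero q m k
  simp only [Fin.revPerm_apply]
  field_simp

theorem antipodeV_one (q : ℂˣ) (m : ℕ) : antipodeV q m 1 = 1 := by
  ext i j
  have := antipodeScalar_ne_zero q m i
  by_cases h : i = j
  · subst h; simp [antipodeV, this]
  · simp [antipodeV, h, Matrix.one_apply, eq_comm]

theorem antipodeScalar_succ (q : ℂˣ) (m : ℕ) (i j : Fin (m + 1)) (h : (i : ℕ) = j + 1) :
    antipodeScalar q m i = -(q : ℂ) ^ wt m i * antipodeScalar q m j := by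
  have hq := q.ne_zero
  have e : ((i : ℕ) : ℤ) * ((m : ℤ) - 1 - (i : ℕ))
      = wt m i + ((j : ℕ) : ℤ) * ((m : ℤ) - 1 - (j : ℕ)) := by
    simp only [wt, h]; push_cast; ring
  rw [antipodeScalar, antipodeScalar, e, zpow_add₀ hq, h, pow_succ]
  ring

theorem wt_rev (m : ℕ) (i : Fin (m + 1)) : wt m (Fin.rev i) = -wt m i := by
  simp only [wt, Fin.val_rev]; omega

theorem antipodeV_rep_gen (q : ℂˣ) (m : ℕ) (x : Gen) :
    antipodeV q m (rep q m (gen q x)) = rep q m (antipode q (gen q x)) := by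
  have hq := q.ne_zero
  have hr (x : Gen) : rep q m (gen q x) = repGen q m x := liftGen_gen ..
  rw [antipode_gen]
  ext i j
  have hi := antipodeScalar_ne_zero q m i
  have hj := antipodeScalar_ne_zero q m j
  cases x
  · simp only [antipodeGen, map_neg, map_mul, hr]
    simp only [antipodeV, repGen, LinearMap.coe_mk, AddHom.coe_mk, Matrix.of_apply,
      Matrix.neg_apply, Matrix.mul_diagonal, Fin.val_rev]
    by_cases h : (i : ℕ) + 1 = j
    · have h' : m + 1 - ((j : ℕ) + 1) + 1 = m + 1 - ((i : ℕ) + 1) := by omega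
      have h₁ : m + 1 - ((i : ℕ) + 1) = m + 1 - j := by omega
      have h₂ : m + 1 - (m + 1 - ((i : ℕ) + 1)) = j := by omega
      rw [if_pos h, if_pos h', h₂, h₁, antipodeScalar_succ q m j i h.symm, zpow_neg]
      field_simp
    · have h' : ¬ (m + 1 - ((j : ℕ) + 1) + 1 = m + 1 - ((i : ℕ) + 1)) := by omega
      rw [if_neg h, if_neg h', mul_zero, zero_mul, neg_zero]
  · simp only [antipodeGen, map_neg, map_mul, hr]
    simp only [antipodeV, repGen, LinearMap.coe_mk, AddHom.coe_mk, Matrix.of_apply,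
      Matrix.neg_apply, Matrix.diagonal_mul, Fin.val_rev]
    by_cases h : (i : ℕ) = j + 1
    · have h' : m + 1 - ((j : ℕ) + 1) = m + 1 - ((i : ℕ) + 1) + 1 := by omega
      rw [if_pos h, if_pos h', antipodeScalar_succ q m i j h]
      field_simp
    · have h' : ¬ (m + 1 - ((j : ℕ) + 1) = m + 1 - ((i : ℕ) + 1) + 1) := by omega
      rw [if_neg h, if_neg h', mul_zero, mul_zero, neg_zero]
  · simp only [antipodeGen, hr]
    simp only [antipodeV, repGen, LinearMap.coe_mk, AddHom.coe_mk, Matrix.of_apply,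
      Matrix.diagonal_apply]
    by_cases h : i = j
    · subst h; simp [hi, wt_rev]
    · simp [h, Ne.symm h]
  · simp only [antipodeGen, hr]
    simp only [antipodeV, repGen, LinearMap.coe_mk, AddHom.coe_mk, Matrix.of_apply,
      Matrix.diagonal_apply]
    by_cases h : i = j
    · subst h; simp [hi, wt_rev]
    · simp [h, Ne.symm h]

theorem antipodeV_rep (q : ℂˣ) (m : ℕ) (u : Uq q) :
    antipodeV q m (rep q m u) = rep q m (antipode q u) := by
  obtain ⟨x, rfl⟩ := mk_surjective q u
  induction x using FreeAlgebra.induction with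
  | grade0 c =>
    rw [AlgHom.commutes, AlgHom.commutes, Algebra.algebraMap_eq_smul_one,
      Algebra.algebraMap_eq_smul_one, map_smul, map_smul, map_smul, antipodeV_one,
      antipode_one, map_one]
  | grade1 x => exact antipodeV_rep_gen q m x
  | mul a b ha hb =>
    rw [map_mul, map_mul, antipodeV_mul, antipode_mul, map_mul, ha, hb]
  | add a b ha hb => simp only [map_add, ha, hb]

/-! ### The universal R-matrix -/

/-- The universal R-matrix
`R = q^{½ H ⊗ H} ∑ₙ q^{n(n+1)/2} (1 - q⁻²)ⁿ / [n]_q! · Eⁿ ⊗ Fⁿ`, evaluated in `B ⊗ B'` for two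
finite-dimensional algebras, where `H, E` act through `h, e ∈ B` in the first factor and `H, F`
through `h', f ∈ B'` in the second one. Here `lnq` is the chosen logarithm of `q`, so that
`q^{½ H ⊗ H} = exp (½ lnq H ⊗ H)`; the exponential is taken for the canonical topology
of the finite-dimensional algebra `B ⊗ B'`, and the sum is finite if `e` or `f` is nilpotent. -/
def rMatrix (q : ℂˣ) (lnq : ℂ) {B B' : Type*} [Ring B] [Algebra ℂ B] [Module.Finite ℂ B]
    [Ring B'] [Algebra ℂ B'] [Module.Finite ℂ B'] (h e : B) (h' f : B') : B ⊗[ℂ] B' :=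
  letI : TopologicalSpace (B ⊗[ℂ] B') := moduleTopology ℂ (B ⊗[ℂ] B')
  haveI : IsModuleTopology ℂ (B ⊗[ℂ] B') := ⟨rfl⟩
  haveI : IsTopologicalRing (B ⊗[ℂ] B') := IsModuleTopology.isTopologicalRing ℂ _
  NormedSpace.exp ((lnq / 2) • (h ⊗ₜ[ℂ] h')) *
    ∑ᶠ n : ℕ, ((q : ℂ) ^ (n * (n + 1) / 2) * (1 - (q : ℂ) ^ (-2 : ℤ)) ^ n / qFactorial q n) •
      ((e ^ n) ⊗ₜ[ℂ] (f ^ n))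

/-- The element `H` (with `q^H = K`) on `V_m`. -/
def hV (m : ℕ) : EndV m := Matrix.diagonal fun i => (wt m i : ℂ)

/-- The quantum adjoint action of `U_q(sl₂)` on `End V_m`:
`u ▷ a = ∑ ρ(u₍₁₎) a S(ρ(u₍₂₎))`. -/
def adV (q : ℂˣ) (m : ℕ) (u : Uq q) : Module.End ℂ (EndV m) :=
  sandwich (EndV m) (TensorProduct.map (rep q m).toLinearMap
    (antipodeV q m ∘ₗ (rep q m).toLinearMap) (comul q u))

/-- The quantum adjoint action of `H` on `End V_m`, with `Δ(H) = H ⊗ 1 + 1 ⊗ H`. -/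
def adHV (q : ℂˣ) (m : ℕ) : Module.End ℂ (EndV m) :=
  sandwich (EndV m) (TensorProduct.map LinearMap.id (antipodeV q m)
    (hV m ⊗ₜ[ℂ] 1 + 1 ⊗ₜ[ℂ] hV m))

/-! ### The completed algebra and its tensor powers -/

/-- The completion of `U_q(sl₂)`. -/
abbrev Compl₁ : Type := (m : ℕ) → EndV m

/-- The completed tensor square. -/
abbrev Compl₂ : Type := (m n : ℕ) → EndV m ⊗[ℂ] EndV n

/-- The completed tensor cube. -/
abbrev Compl₃ : Type := (m n k : ℕ) → EndV m ⊗[ℂ] (EndV n ⊗[ℂ] EndV k)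

/-- The canonical map from `U_q(sl₂)` to its completion. -/
def toCompl (q : ℂˣ) : Uq q →ₐ[ℂ] Compl₁ := AlgHom.pi (rep q)

/-- The braided coproduct `Δ̲(u) = ∑ u₍₁₎ S(R₂) ⊗ R₁ ▷ u₍₂₎`. -/
def braidedComul (q : ℂˣ) (lnq : ℂ) (u : Uq q) : Compl₂ := fun m n =>
  TensorProduct.lift (LinearMap.mk₂ ℂ
    (fun (R₁ : Module.End ℂ (EndV n)) (R₂ : EndV m) =>
      (TensorProduct.map (LinearMap.mulRight ℂ (antipodeV q m R₂)) R₁ :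
        EndV m ⊗[ℂ] EndV n →ₗ[ℂ] EndV m ⊗[ℂ] EndV n))
    (fun _ _ _ => by ext1; simp [TensorProduct.map_add_right])
    (fun _ _ _ => by ext1; simp [TensorProduct.map_smul_right])
    (fun _ _ _ => by ext; simp [mul_add, TensorProduct.add_tmul])
    (fun _ _ _ => by ext; simp [TensorProduct.smul_tmul']))
    (rMatrix q lnq (adHV q n) (adV q n (E q)) (hV m) (rep q m (F q)))
    (TensorProduct.map (rep q m).toLinearMap (rep q n).toLinearMap (comul q u))

/-- The braided antipode `S̲(a) = ∑ R₂ S(R₁ ▷ a)`, on the component `End V_m`. -/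
def braidedAntipode (q : ℂˣ) (lnq : ℂ) (m : ℕ) : EndV m →ₗ[ℂ] EndV m :=
  TensorProduct.lift (LinearMap.mk₂ ℂ
    (fun (R₁ : Module.End ℂ (EndV m)) (R₂ : EndV m) =>
      (LinearMap.mulLeft ℂ R₂ ∘ₗ antipodeV q m ∘ₗ R₁ : EndV m →ₗ[ℂ] EndV m))
    (fun _ _ _ => by ext1; simp [mul_add])
    (fun _ _ _ => by ext1; simp)
    (fun _ _ _ => by ext1; simp [add_mul])
    (fun _ _ _ => by ext1; simp))
    (rMatrix q lnq (adHV q m) (adV q m (E q)) (hV m) (rep q m (F q)))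

/-- The braiding `R̂ = T ∘ R : a ⊗ b ↦ ∑ R₂ ▷ b ⊗ R₁ ▷ a`, where `T` is the flip and `R` acts
through the quantum adjoint action on both factors. -/
def braiding (q : ℂˣ) (lnq : ℂ) (m n : ℕ) : EndV m ⊗[ℂ] EndV n →ₗ[ℂ] EndV n ⊗[ℂ] EndV m :=
  (TensorProduct.comm ℂ (EndV m) (EndV n)).toLinearMap ∘ₗ
    TensorProduct.homTensorHomMap (.id ℂ) (EndV m) (EndV n) (EndV m) (EndV n)
      (rMatrix q lnq (adHV q m) (adV q m (E q)) (adHV q n) (adV q n (F q)))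

/-- `x ⊗ y` in the completed tensor cube, for `x` in the completed tensor square. -/
def tmul₂₁ (x : Compl₂) (y : Compl₁) : Compl₃ := fun m n k =>
  TensorProduct.assoc ℂ (EndV m) (EndV n) (EndV k) (x m n ⊗ₜ[ℂ] y k)

/-- `Id ⊗ S̲ ⊗ Id` on the completed tensor cube. -/
def idAntipodeId (q : ℂˣ) (lnq : ℂ) (x : Compl₃) : Compl₃ := fun m n k =>
  TensorProduct.map LinearMap.id
    (TensorProduct.map (braidedAntipode q lnq n) LinearMap.id) (x m n k)

/-- `Id ⊗ R̂` on the completed tensor cube. -/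
def idBraiding (q : ℂˣ) (lnq : ℂ) (x : Compl₃) : Compl₃ := fun m n k =>
  TensorProduct.map LinearMap.id (braiding q lnq k n) (x m k n)

/-- The multiplication `x ⊗ y ⊗ z ↦ x y z` from the completed tensor cube to the completion. -/
def mul₃ (x : Compl₃) : Compl₁ := fun m =>
  LinearMap.mul' ℂ (EndV m)
    (TensorProduct.map LinearMap.id (LinearMap.mul' ℂ (EndV m)) (x m m m))

/-- The braided adjoint action
`ad̲_u(X) = (·² ∘ (Id ⊗ R̂) ∘ (Id ⊗ S̲ ⊗ Id) ∘ (Δ̲ ⊗ Id)) (u ⊗ X)` of `U_q(sl₂)` on itself, with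
values in the completion. -/
def braidedAd (q : ℂˣ) (lnq : ℂ) (u X : Uq q) : Compl₁ :=
  mul₃ (idBraiding q lnq (idAntipodeId q lnq
    (tmul₂₁ (braidedComul q lnq u) (toCompl q X))))

end

end QuantumSL2

/-!
The braided adjoint action only involves universal R-matrices whose first factor acts on `End V_m`
by the adjoint action. The weights of this action are even and `E` acts nilpotently, so each such
R-matrix is the image of a finite sum in `End (End V_m) ⊗ U_q(sl₂)` without fractional powers of
`K` (`rMatrix_eq_map`), and no logarithm of `q` is left. It is best regarded as the map
`T : A ↦ ∑ R₁ ▷ A ⊗ R₂` from `End V_m` to `End V_m ⊗ U_q(sl₂)` (`coact`). The argument uses four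
properties of `T`:

* `(Id ⊗ Δ)(R) = R₁₃ R₁₂`, that is, `T` is a coaction for the opposite coproduct
  (`map_comul_coact`); by weights, this is the `q`-binomial theorem `rCoeff_smul_add_pow`;
* `(Id ⊗ ε)(R) = 1` (`map_counit_coact`);
* `R Δ(E) = Δᵒᵖ(E) R` (`coact_adV_E`), from the commutator of `E` with `Fⁿ`; it implies that the
  braided antipode `S̲(A) = ∑ R₂ S(R₁ ▷ A)` commutes with the adjoint action of `E`;
* hence `T` commutes with `S̲` (`coact_coactAntipode`).

With `R`, `R'` two copies of the R-matrix, the braided adjoint action is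
`∑ u₍₁₎ S(R₂) (R'₂ ▷ X) (R'₁ ▷ S̲(R₁ ▷ u₍₂₎))`. As `T` commutes with `S̲`, the operators `R'₁` and
`R₁` act in succession on `u₍₂₎`, and the coaction property turns the second factors into a
coproduct. The Hopf identity `∑ S(h₍₁₎) (h₍₂₎ ▷ X) = X S(h)` (`antipodeAd_comul`) then gives
`∑ u₍₁₎ X S(R₂) S̲(R₁ ▷ u₍₂₎)`; the same reasoning with `∑ S(h₍₁₎) h₍₂₎ = ε(h)` shows
`∑ S(R₂) S̲(R₁ ▷ A) = S(A)`, and what remains is `∑ u₍₁₎ X S(u₍₂₎)`.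

The map to the completion is injective because `U_q(sl₂)` is spanned by the monomials
`F^a K^b E^c`, and the coefficient of `v_a` in `u v_c ∈ V_m`, for the least `c` that occurs in `u`
and all large `m`, is a nonzero multiple of `∑_b x_{a,b,c} q^{bm}`; the exponential functions
`m ↦ q^{bm}` are linearly independent as `q` is not a root of unity.
-/

namespace QuantumSL2

noncomputable section

/-! ### Commutation relations in `U_q(sl₂)` -/

/-- To prove a property of all elements of `U_q(sl₂)` it suffices to treat scalars and generators,
and to show closure under products and sums. -/
theorem Uq.induction {q : ℂˣ} {p : Uq q → Prop} (scalar : ∀ c : ℂ, p (algebraMap ℂ (Uq q) c))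
    (gen : ∀ x, p (gen q x)) (mul : ∀ u v, p u → p v → p (u * v))
    (add : ∀ u v, p u → p v → p (u + v)) (u : Uq q) : p u := by
  obtain ⟨x, rfl⟩ := mk_surjective q u
  induction x using FreeAlgebra.induction with
  | grade0 c => rw [AlgHom.commutes]; exact scalar c
  | grade1 x => exact gen x
  | mul a b ha hb => rw [map_mul]; exact mul _ _ ha hb
  | add a b ha hb => rw [map_add]; exact add _ _ ha hb

/-- The parameter `q⁻²`, in which the coefficients of the universal R-matrix are most naturally
expressed. -/
def qInvSq (q : ℂˣ) : ℂ := (q : ℂ) ^ (-2 : ℤ)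

/-- `q - q⁻¹`. -/
def qDiff (q : ℂˣ) : ℂ := (q : ℂ) - (q : ℂ)⁻¹

theorem qInvSq_ne_zero (q : ℂˣ) : qInvSq q ≠ 0 := zpow_ne_zero _ q.ne_zero

theorem qInvSq_eq (q : ℂˣ) : qInvSq q = ((q : ℂ) ^ 2)⁻¹ := zpow_neg _ 2

theorem one_sub_qInvSq_pow_ne_zero {q : ℂˣ} (hq : ∀ n : ℕ, 0 < n → q ^ n ≠ 1) (n : ℕ) :
    1 - qInvSq q ^ (n + 1) ≠ 0 := by
  intro h
  apply hq (2 * (n + 1)) (by omega)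
  rw [qInvSq_eq, inv_pow, sub_eq_zero, eq_comm, inv_eq_one, ← pow_mul] at h
  exact Units.ext (by rw [Units.val_pow_eq_pow_val, h, Units.val_one])

theorem qDiff_eq (q : ℂˣ) : qDiff q = q * (1 - qInvSq q) := by
  have := q.ne_zero
  rw [qDiff, qInvSq_eq]
  field_simp

theorem qDiff_ne_zero {q : ℂˣ} (hq : ∀ n : ℕ, 0 < n → q ^ n ≠ 1) : qDiff q ≠ 0 := by
  rw [qDiff_eq]
  have := one_sub_qInvSq_pow_ne_zero hq 0
  simp only [zero_add, pow_one] at this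
  exact mul_ne_zero q.ne_zero this

theorem qNum_succ_eq (q : ℂˣ) (n : ℕ) :
    qNum q (n + 1) = q ^ (n + 1) * (1 - qInvSq q ^ (n + 1)) / qDiff q := by
  have := q.ne_zero
  have h : qInvSq q = (q : ℂ)⁻¹ * (q : ℂ)⁻¹ := by
    rw [qInvSq_eq, sq, mul_inv]
  rw [qNum, qDiff, h, mul_pow, mul_sub, mul_one, ← mul_assoc, ← mul_pow, mul_inv_cancel₀ this,
    one_pow, one_mul]

theorem qNum_succ_ne_zero {q : ℂˣ} (hq : ∀ n : ℕ, 0 < n → q ^ n ≠ 1) (n : ℕ) :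
    qNum q (n + 1) ≠ 0 := by
  rw [qNum_succ_eq]
  exact div_ne_zero (mul_ne_zero (pow_ne_zero _ q.ne_zero) (one_sub_qInvSq_pow_ne_zero hq n))
    (qDiff_ne_zero hq)

theorem zpow_injective {q : ℂˣ} (hq : ∀ n : ℕ, 0 < n → q ^ n ≠ 1) :
    Function.Injective fun j : ℤ => (q : ℂ) ^ j := by
  have : ¬ IsOfFinOrder q := by
    rw [isOfFinOrder_iff_pow_eq_one]; rintro ⟨n, hn, h⟩; exact hq n hn h
  intro i j h
  apply injective_zpow_iff_not_isOfFinOrder.mpr this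
  ext
  simpa using h

/-- `K` as a unit of `U_q(sl₂)`. -/
def Kunit (q : ℂˣ) : (Uq q)ˣ := ⟨K q, Kinv q, K_mul_Kinv q, Kinv_mul_K q⟩

/-- The integral powers of `K`. -/
def Kpow (q : ℂˣ) (j : ℤ) : Uq q := ((Kunit q ^ j : (Uq q)ˣ) : Uq q)

theorem Kpow_zero (q : ℂˣ) : Kpow q 0 = 1 := by simp [Kpow]

theorem Kpow_one (q : ℂˣ) : Kpow q 1 = K q := by simp [Kpow, Kunit]

theorem Kpow_neg_one (q : ℂˣ) : Kpow q (-1) = Kinv q := by simp [Kpow, Kunit]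

theorem Kpow_add (q : ℂˣ) (i j : ℤ) : Kpow q (i + j) = Kpow q i * Kpow q j := by
  simp [Kpow, zpow_add]

theorem Kpow_add_one (q : ℂˣ) (j : ℤ) : Kpow q (j + 1) = Kpow q j * K q := by
  rw [Kpow_add, Kpow_one]

theorem K_mul_Kpow (q : ℂˣ) (j : ℤ) : K q * Kpow q j = Kpow q (j + 1) := by
  rw [add_comm, Kpow_add, Kpow_one]

theorem Kinv_mul_Kpow (q : ℂˣ) (j : ℤ) : Kinv q * Kpow q j = Kpow q (j - 1) := by
  rw [sub_eq_add_neg, add_comm, Kpow_add, Kpow_neg_one]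

/-- If a unit `k` commutes with `x` up to the scalar `c`, then `k ^ j` does so up to `c ^ j`. -/
theorem units_zpow_mul_of_mul {A : Type*} [Ring A] [Algebra ℂ A] (k : Aˣ) {x : A} {c : ℂ}
    (hc : c ≠ 0) (h : k * x = c • (x * k)) (j : ℤ) :
    ((k ^ j : Aˣ) : A) * x = c ^ j • (x * ((k ^ j : Aˣ) : A)) := by
  have h' : ((k⁻¹ : Aˣ) : A) * x = c⁻¹ • (x * ((k⁻¹ : Aˣ) : A)) := by
    rw [Units.inv_mul_eq_iff_eq_mul, mul_smul_comm, ← mul_assoc, h, smul_mul_assoc, smul_smul,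
      inv_mul_cancel₀ hc, one_smul, mul_assoc, Units.mul_inv, mul_one]
  induction j with
  | zero => simp
  | succ n ih =>
    rw [zpow_add, zpow_one, Units.val_mul, mul_assoc, h, mul_smul_comm, ← mul_assoc, ih,
      smul_mul_assoc, smul_smul, zpow_add₀ hc, zpow_one, mul_comm c, mul_assoc]
  | pred n ih =>
    rw [sub_eq_add_neg, zpow_add, zpow_neg_one, Units.val_mul, mul_assoc, h', mul_smul_comm,
      ← mul_assoc, ih, smul_mul_assoc, smul_smul, zpow_add₀ hc, zpow_neg_one, mul_comm c⁻¹,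
      mul_assoc]

theorem Kpow_mul_E (q : ℂˣ) (j : ℤ) : Kpow q j * E q = ((q : ℂ) ^ 2) ^ j • (E q * Kpow q j) :=
  units_zpow_mul_of_mul (Kunit q) (pow_ne_zero 2 q.ne_zero) (K_mul_E q) j

theorem sq_mul_qInvSq (q : ℂˣ) : (q : ℂ) ^ 2 * qInvSq q = 1 := sq_mul_zpow q

theorem E_mul_Kpow (q : ℂˣ) (j : ℤ) : E q * Kpow q j = qInvSq q ^ j • (Kpow q j * E q) := by
  rw [Kpow_mul_E, smul_smul, ← mul_zpow, mul_comm, sq_mul_qInvSq, one_zpow, one_smul]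

theorem K_mul_F_pow (q : ℂˣ) (n : ℕ) : K q * F q ^ n = qInvSq q ^ n • (F q ^ n * K q) := by
  induction n with
  | zero => simp
  | succ n ih =>
    rw [pow_succ, ← mul_assoc, ih, smul_mul_assoc, mul_assoc, K_mul_F, ← qInvSq, mul_smul_comm,
      smul_smul, ← pow_succ, mul_assoc]

theorem F_pow_mul_Kinv (q : ℂˣ) (n : ℕ) :
    F q ^ n * Kinv q = qInvSq q ^ n • (Kinv q * F q ^ n) := by
  have h := congrArg (fun x => Kinv q * x * Kinv q) (K_mul_F_pow q n)
  simp only [mul_smul_comm, smul_mul_assoc] at h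
  rw [← mul_assoc, Kinv_mul_K, one_mul] at h
  rw [h, mul_assoc, mul_assoc, K_mul_Kinv, mul_one]

theorem E_mul_F (q : ℂˣ) :
    E q * F q = F q * E q + (qDiff q)⁻¹ • (K q - Kinv q) := by
  rw [qDiff, ← E_mul_F_sub, add_sub_cancel]

/-- The commutator of `E` with a power of `F`, cleared of denominators. -/
theorem E_mul_F_pow {q : ℂˣ} (hq : ∀ n : ℕ, 0 < n → q ^ n ≠ 1) (n : ℕ) :
    E q * F q ^ (n + 1) = F q ^ (n + 1) * E q +
      ((1 - qInvSq q ^ (n + 1)) / (qDiff q * (1 - qInvSq q))) •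
        (F q ^ n * K q - Kinv q * F q ^ n) := by
  have h1 : 1 - qInvSq q ≠ 0 := by simpa using one_sub_qInvSq_pow_ne_zero hq 0
  have h2 := qDiff_ne_zero hq
  induction n with
  | zero =>
    have : (1 - qInvSq q) / (qDiff q * (1 - qInvSq q)) = (qDiff q)⁻¹ := by field_simp
    simp only [zero_add, pow_one, pow_zero, one_mul, mul_one, this, E_mul_F]
  | succ n ih =>
    have e1 : F q ^ n * K q * F q = qInvSq q • (F q ^ (n + 1) * K q) := by
      rw [mul_assoc, K_mul_F, ← qInvSq, mul_smul_comm, pow_succ, mul_assoc]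
    rw [pow_succ _ (n + 1), ← mul_assoc, ih, add_mul, mul_assoc, E_mul_F, mul_add,
      smul_mul_assoc, sub_mul, e1, mul_assoc (Kinv q), ← pow_succ, mul_smul_comm, mul_sub,
      F_pow_mul_Kinv, ← mul_assoc, add_assoc]
    congr 1
    generalize F q ^ (n + 1) * K q = x
    generalize Kinv q * F q ^ (n + 1) = y
    match_scalars <;> field_simp <;> ring

/-! ### The coefficients of the universal R-matrix -/

/-- The coefficient of `Eⁿ ⊗ Fⁿ` in the universal R-matrix. -/
def rCoeff (q : ℂˣ) (n : ℕ) : ℂ :=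
  (q : ℂ) ^ (n * (n + 1) / 2) * (1 - (q : ℂ) ^ (-2 : ℤ)) ^ n / qFactorial q n

theorem rCoeff_zero (q : ℂˣ) : rCoeff q 0 = 1 := by simp [rCoeff, qFactorial]

/-- The recursion which determines the coefficients of the universal R-matrix. -/
theorem rCoeff_succ {q : ℂˣ} (hq : ∀ n : ℕ, 0 < n → q ^ n ≠ 1) (n : ℕ) :
    rCoeff q (n + 1) * (1 - qInvSq q ^ (n + 1)) = qDiff q * (1 - qInvSq q) * rCoeff q n := by
  have h0 : qFactorial q n ≠ 0 := Finset.prod_ne_zero_iff.mpr fun i _ => qNum_succ_ne_zero hq i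
  have h1 : 1 - qInvSq q ≠ 0 := by simpa using one_sub_qInvSq_pow_ne_zero hq 0
  have h2 := qDiff_ne_zero hq
  have h3 := one_sub_qInvSq_pow_ne_zero hq n
  have h4 := q.ne_zero
  have e : (n + 1) * (n + 1 + 1) / 2 = n * (n + 1) / 2 + (n + 1) := by
    rw [show (n + 1) * (n + 1 + 1) = n * (n + 1) + (n + 1) * 2 by ring,
      Nat.add_mul_div_right _ _ (by norm_num)]
  have e' : qFactorial q (n + 1) = qFactorial q n * qNum q (n + 1) :=
    Finset.prod_range_succ ..
  rw [rCoeff, rCoeff, e, e', qNum_succ_eq, ← qInvSq, pow_add]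
  field_simp
  ring

theorem rCoeff_smul_E_mul_F_pow {q : ℂˣ} (hq : ∀ n : ℕ, 0 < n → q ^ n ≠ 1) (n : ℕ) :
    rCoeff q (n + 1) • (E q * F q ^ (n + 1)) = rCoeff q (n + 1) • (F q ^ (n + 1) * E q) +
      rCoeff q n • (F q ^ n * K q - Kinv q * F q ^ n) := by
  have h1 : 1 - qInvSq q ≠ 0 := by simpa using one_sub_qInvSq_pow_ne_zero hq 0
  have h2 := qDiff_ne_zero hq
  rw [E_mul_F_pow hq, smul_add, smul_smul]
  congr 2
  rw [mul_div_assoc', rCoeff_succ hq]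
  field_simp

/-- The `q`-binomial theorem, for elements with `x * y = q⁻² y * x` and with the binomial
coefficients written through the coefficients of the R-matrix. -/
theorem rCoeff_smul_add_pow {q : ℂˣ} (hq : ∀ n : ℕ, 0 < n → q ^ n ≠ 1) {A : Type*} [Ring A]
    [Algebra ℂ A] {x y : A} (h : x * y = qInvSq q • (y * x)) (N : ℕ) :
    rCoeff q N • (x + y) ^ N = ∑ p ∈ Finset.HasAntidiagonal.antidiagonal N,
      (rCoeff q p.1 * rCoeff q p.2) • (y ^ p.2 * x ^ p.1) := by
  have hxy (m : ℕ) : x * y ^ m = qInvSq q ^ m • (y ^ m * x) := by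
    induction m with
    | zero => simp
    | succ m ih =>
      rw [pow_succ, ← mul_assoc, ih, smul_mul_assoc, mul_assoc, h, mul_smul_comm, smul_smul,
        ← pow_succ, mul_assoc]
  induction N with
  | zero => simp [rCoeff_zero]
  | succ N ih =>
    have h3 := one_sub_qInvSq_pow_ne_zero hq N
    apply smul_right_injective A h3
    simp only [smul_smul]
    rw [mul_comm, rCoeff_succ hq, pow_succ', mul_smul, ← mul_smul_comm, ih, Finset.smul_sum]
    have e : ∀ p ∈ Finset.HasAntidiagonal.antidiagonal (N + 1),
        (1 - qInvSq q ^ (N + 1)) • (rCoeff q p.1 * rCoeff q p.2) • (y ^ p.2 * x ^ p.1) =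
        (qInvSq q ^ p.2 * ((rCoeff q p.1 * (1 - qInvSq q ^ p.1)) * rCoeff q p.2)) •
            (y ^ p.2 * x ^ p.1) +
          (rCoeff q p.1 * (rCoeff q p.2 * (1 - qInvSq q ^ p.2))) • (y ^ p.2 * x ^ p.1) := by
      intro p hp
      rw [smul_smul, ← add_smul, ← Finset.HasAntidiagonal.mem_antidiagonal.mp hp, pow_add]
      congr 1
      ring
    rw [Finset.sum_congr rfl e, Finset.sum_add_distrib, Finset.Nat.sum_antidiagonal_succ,
      Finset.Nat.sum_antidiagonal_succ']
    simp only [rCoeff_succ hq, pow_zero, sub_self, mul_zero, zero_mul, zero_smul, zero_add]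
    rw [← Finset.sum_add_distrib, Finset.mul_sum, Finset.smul_sum]
    refine Finset.sum_congr rfl fun p _ => ?_
    rw [mul_smul_comm, add_mul, ← mul_assoc, hxy, smul_mul_assoc, mul_assoc, ← pow_succ',
      ← mul_assoc, ← pow_succ' y, smul_smul, smul_add, smul_smul]
    congr 2 <;> ring

/-! ### Counit, antipode and adjoint action -/

/-- The counit of `U_q(sl₂)`. -/
def counit (q : ℂˣ) : Uq q →ₐ[ℂ] ℂ :=
  liftGen q (fun x => match x with | Gen.E => 0 | Gen.F => 0 | Gen.K => 1 | Gen.Kinv => 1)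
    (by simp) (by simp) (by simp) (by simp) (by simp)

theorem counit_F (q : ℂˣ) : counit q (F q) = 0 := liftGen_gen ..

theorem counit_K (q : ℂˣ) : counit q (K q) = 1 := liftGen_gen ..

theorem counit_Kpow (q : ℂˣ) (j : ℤ) : counit q (Kpow q j) = 1 := by
  have h : Units.map (counit q : Uq q →* ℂ) (Kunit q) = 1 := Units.ext (counit_K q)
  have := congrArg Units.val (map_zpow (Units.map (counit q : Uq q →* ℂ)) (Kunit q) j)
  rw [h, one_zpow] at this
  exact this

theorem comul_E (q : ℂˣ) : comul q (E q) = E q ⊗ₜ K q + 1 ⊗ₜ E q := liftGen_gen ..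

theorem comul_F (q : ℂˣ) : comul q (F q) = F q ⊗ₜ 1 + Kinv q ⊗ₜ F q := liftGen_gen ..

theorem comul_K (q : ℂˣ) : comul q (K q) = K q ⊗ₜ K q := liftGen_gen ..

theorem comul_Kinv (q : ℂˣ) : comul q (Kinv q) = Kinv q ⊗ₜ Kinv q := liftGen_gen ..

theorem comul_Kpow (q : ℂˣ) (j : ℤ) : comul q (Kpow q j) = Kpow q j ⊗ₜ Kpow q j := by
  induction j with
  | zero => simp [Kpow_zero, Algebra.TensorProduct.one_def]
  | succ n ih =>
    rw [Kpow_add_one, map_mul, ih, comul_K, Algebra.TensorProduct.tmul_mul_tmul]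
  | pred n ih =>
    rw [sub_eq_add_neg, Kpow_add, Kpow_neg_one, map_mul, ih, comul_Kinv,
      Algebra.TensorProduct.tmul_mul_tmul]

theorem antipode_E (q : ℂˣ) : antipode q (E q) = -(E q * Kinv q) := antipode_gen q _

theorem antipode_F (q : ℂˣ) : antipode q (F q) = -(K q * F q) := antipode_gen q _

theorem antipode_K (q : ℂˣ) : antipode q (K q) = Kinv q := antipode_gen q _

theorem antipode_Kinv (q : ℂˣ) : antipode q (Kinv q) = K q := antipode_gen q _

/-- The linear map `x ⊗ y ↦ S(x) y`. -/
def antipodeMul (q : ℂˣ) : Uq q ⊗[ℂ] Uq q →ₗ[ℂ] Uq q :=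
  LinearMap.mul' ℂ (Uq q) ∘ₗ TensorProduct.map (antipode q) LinearMap.id

@[simp]
theorem antipodeMul_tmul (q : ℂˣ) (x y : Uq q) :
    antipodeMul q (x ⊗ₜ y) = antipode q x * y := rfl

theorem antipodeMul_mul_tmul (q : ℂˣ) (z : Uq q ⊗[ℂ] Uq q) (x y : Uq q) :
    antipodeMul q (z * x ⊗ₜ y) = antipode q x * antipodeMul q z * y := by
  induction z with
  | zero => simp
  | tmul a b => simp [antipode_mul, mul_assoc]
  | add a b ha hb => simp only [add_mul, mul_add, map_add, ha, hb]

/-- The antipode axiom `∑ S(u₍₁₎) u₍₂₎ = ε(u)`. -/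
theorem antipodeMul_comul (q : ℂˣ) (u : Uq q) :
    antipodeMul q (comul q u) = counit q u • 1 := by
  induction u using Uq.induction with
  | scalar c =>
    rw [AlgHom.commutes, AlgHom.commutes, Algebra.algebraMap_eq_smul_one, map_smul,
      Algebra.TensorProduct.one_def, antipodeMul_tmul, antipode_one, one_mul]
    rfl
  | gen x =>
    cases x
    · rw [comul_E, map_add, antipodeMul_tmul, antipodeMul_tmul, antipode_one, antipode_E,
        neg_mul, mul_assoc, Kinv_mul_K]
      simp [counit, liftGen_gen]
    · rw [comul_F, map_add, antipodeMul_tmul, antipodeMul_tmul, antipode_Kinv, antipode_F]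
      simp [counit, liftGen_gen]
    · rw [comul_K, antipodeMul_tmul, antipode_K, Kinv_mul_K]
      simp [counit, liftGen_gen]
    · rw [comul_Kinv, antipodeMul_tmul, antipode_Kinv, K_mul_Kinv]
      simp [counit, liftGen_gen]
  | mul u v hu hv =>
    have key (w : Uq q ⊗[ℂ] Uq q) :
        antipodeMul q (comul q u * w) = counit q u • antipodeMul q w := by
      induction w with
      | zero => simp
      | tmul x y => rw [antipodeMul_mul_tmul, hu]; simp
      | add a b ha hb => simp only [mul_add, map_add, ha, hb, smul_add]
    rw [map_mul, key, hv, map_mul, smul_smul]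
  | add u v hu hv => simp only [map_add, hu, hv, add_smul]

/-- The linear map `x ⊗ y ↦ (A ↦ ρ(x) A S(ρ(y)))` that gives the adjoint action on `End V_m`. -/
def bimodAct (q : ℂˣ) (m : ℕ) : Uq q ⊗[ℂ] Uq q →ₗ[ℂ] Module.End ℂ (EndV m) :=
  sandwich (EndV m) ∘ₗ TensorProduct.map (rep q m).toLinearMap
    (antipodeV q m ∘ₗ (rep q m).toLinearMap)

@[simp]
theorem bimodAct_tmul (q : ℂˣ) (m : ℕ) (x y : Uq q) (A : EndV m) :
    bimodAct q m (x ⊗ₜ y) A = rep q m x * (A * antipodeV q m (rep q m y)) := rfl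

theorem adV_eq_bimodAct (q : ℂˣ) (m : ℕ) (u : Uq q) :
    adV q m u = bimodAct q m (comul q u) := rfl

theorem bimodAct_mul (q : ℂˣ) (m : ℕ) (z w : Uq q ⊗[ℂ] Uq q) :
    bimodAct q m (z * w) = bimodAct q m z * bimodAct q m w := by
  induction z with
  | zero => simp
  | add a b ha hb => simp only [add_mul, map_add, ha, hb]
  | tmul a b =>
    induction w with
    | zero => simp
    | add a b ha hb => simp only [mul_add, map_add, ha, hb]
    | tmul x y =>
      refine LinearMap.ext fun A => ?_
      simp only [Algebra.TensorProduct.tmul_mul_tmul, bimodAct_tmul, Module.End.mul_apply,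
        map_mul, antipodeV_mul, mul_assoc]

theorem bimodAct_one (q : ℂˣ) (m : ℕ) : bimodAct q m 1 = 1 := by
  refine LinearMap.ext fun A => ?_
  simp [Algebra.TensorProduct.one_def, antipodeV_one]

/-- The quantum adjoint action on `End V_m`, as an algebra homomorphism. -/
def adHom (q : ℂˣ) (m : ℕ) : Uq q →ₐ[ℂ] Module.End ℂ (EndV m) :=
  AlgHom.ofLinearMap (bimodAct q m ∘ₗ (comul q).toLinearMap)
    (by simp [bimodAct_one]) (by simp [bimodAct_mul])

theorem adHom_apply (q : ℂˣ) (m : ℕ) (u : Uq q) : adHom q m u = adV q m u := rfl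

theorem adV_E (q : ℂˣ) (m : ℕ) (A : EndV m) : adV q m (E q) A =
    (rep q m (E q) * A - A * rep q m (E q)) * rep q m (Kinv q) := by
  rw [adV_eq_bimodAct, comul_E, map_add, LinearMap.add_apply, bimodAct_tmul, bimodAct_tmul,
    antipodeV_rep, antipodeV_rep, antipode_E, antipode_K, map_one, map_neg, map_mul]
  noncomm_ring

theorem adV_F (q : ℂˣ) (m : ℕ) (A : EndV m) : adV q m (F q) A =
    rep q m (F q) * A - rep q m (Kinv q) * A * rep q m (K q) * rep q m (F q) := by
  rw [adV_eq_bimodAct, comul_F, map_add, LinearMap.add_apply, bimodAct_tmul, bimodAct_tmul,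
    antipodeV_rep, antipodeV_rep, antipode_F, antipode_one, map_one, map_neg, map_mul]
  noncomm_ring

theorem adV_K (q : ℂˣ) (m : ℕ) (A : EndV m) : adV q m (K q) A =
    rep q m (K q) * A * rep q m (Kinv q) := by
  rw [adV_eq_bimodAct, comul_K, bimodAct_tmul, antipodeV_rep, antipode_K, mul_assoc]

theorem adV_Kinv (q : ℂˣ) (m : ℕ) (A : EndV m) : adV q m (Kinv q) A =
    rep q m (Kinv q) * A * rep q m (K q) := by
  rw [adV_eq_bimodAct, comul_Kinv, bimodAct_tmul, antipodeV_rep, antipode_Kinv, mul_assoc]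

/-- The representations intertwine the quantum adjoint actions of `U_q(sl₂)` on itself and on
`End V_m`. -/
theorem rep_ad (q : ℂˣ) (m : ℕ) (u X : Uq q) :
    rep q m (ad q u X) = adV q m u (rep q m X) := by
  rw [adV_eq_bimodAct, ad]
  induction comul q u with
  | zero => simp
  | tmul x y =>
    rw [bimodAct_tmul, antipodeV_rep, ← map_mul, ← map_mul]
    rfl
  | add a b ha hb => simp only [map_add, LinearMap.add_apply, ha, hb]

/-- The linear map `x ⊗ y ↦ (A ↦ S(ρ(x)) (y ▷ A))`. -/
def antipodeAd (q : ℂˣ) (m : ℕ) : Uq q ⊗[ℂ] Uq q →ₗ[ℂ] Module.End ℂ (EndV m) :=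
  LinearMap.mul' ℂ (Module.End ℂ (EndV m)) ∘ₗ TensorProduct.map
    (LinearMap.mul ℂ (EndV m) ∘ₗ (rep q m).toLinearMap ∘ₗ antipode q) (adHom q m).toLinearMap

@[simp]
theorem antipodeAd_tmul (q : ℂˣ) (m : ℕ) (x y : Uq q) (A : EndV m) :
    antipodeAd q m (x ⊗ₜ y) A = rep q m (antipode q x) * adV q m y A := rfl

theorem antipodeAd_mul_tmul (q : ℂˣ) (m : ℕ) (z : Uq q ⊗[ℂ] Uq q) (x y : Uq q) (A : EndV m) :
    antipodeAd q m (z * x ⊗ₜ y) A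
      = rep q m (antipode q x) * antipodeAd q m z (adV q m y A) := by
  induction z with
  | zero => simp
  | tmul a b =>
    rw [Algebra.TensorProduct.tmul_mul_tmul, antipodeAd_tmul, antipodeAd_tmul, antipode_mul,
      map_mul, ← adHom_apply, ← adHom_apply, ← adHom_apply, map_mul, Module.End.mul_apply,
      mul_assoc]
  | add a b ha hb => simp only [add_mul, mul_add, map_add, LinearMap.add_apply, ha, hb]

/-- The identity `∑ S(u₍₁₎) (u₍₂₎ ▷ A) = A S(u)`. -/
theorem antipodeAd_comul (q : ℂˣ) (m : ℕ) (u : Uq q) (A : EndV m) :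
    antipodeAd q m (comul q u) A = A * rep q m (antipode q u) := by
  have hK : rep q m (K q) * rep q m (Kinv q) = 1 := by rw [← map_mul, K_mul_Kinv, map_one]
  have hK' : rep q m (Kinv q) * rep q m (K q) = 1 := by rw [← map_mul, Kinv_mul_K, map_one]
  induction u using Uq.induction generalizing A with
  | scalar c =>
    rw [AlgHom.commutes, Algebra.algebraMap_eq_smul_one, Algebra.algebraMap_eq_smul_one, map_smul,
      Algebra.TensorProduct.one_def, LinearMap.smul_apply, antipodeAd_tmul, map_smul,
      antipode_one, map_one, one_mul, map_smul, map_one, mul_smul_comm, mul_one, ← adHom_apply,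
      map_one, Module.End.one_apply]
  | gen x =>
    cases x
    · rw [comul_E, map_add, LinearMap.add_apply, antipodeAd_tmul, antipodeAd_tmul, antipode_one,
        antipode_E, adV_K, adV_E, map_one, map_neg, map_mul, one_mul, neg_mul, mul_assoc,
        mul_assoc (rep q m (K q)), ← mul_assoc (rep q m (Kinv q)), hK']
      noncomm_ring
    · rw [comul_F, map_add, LinearMap.add_apply, antipodeAd_tmul, antipodeAd_tmul, antipode_F,
        antipode_Kinv, adV_F, ← adHom_apply, map_one, Module.End.one_apply, map_neg, map_mul,
        mul_sub, mul_assoc (rep q m (Kinv q)), mul_assoc (rep q m (Kinv q)), ← mul_assoc _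
          (rep q m (Kinv q)), hK]
      noncomm_ring
    · rw [comul_K, antipodeAd_tmul, antipode_K, adV_K, ← mul_assoc, ← mul_assoc, hK', one_mul]
    · rw [comul_Kinv, antipodeAd_tmul, antipode_Kinv, adV_Kinv, ← mul_assoc, ← mul_assoc, hK,
        one_mul]
  | mul u v hu hv =>
    have key (w : Uq q ⊗[ℂ] Uq q) : antipodeAd q m (comul q u * w) A
        = antipodeAd q m w A * rep q m (antipode q u) := by
      induction w with
      | zero => simp
      | tmul x y => rw [antipodeAd_mul_tmul, hu, antipodeAd_tmul, mul_assoc]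
      | add a b ha hb => simp only [mul_add, map_add, LinearMap.add_apply, ha, hb, add_mul]
    rw [map_mul, key, hv, antipode_mul, map_mul, mul_assoc]
  | add u v hu hv => simp only [map_add, LinearMap.add_apply, hu, hv, mul_add]

/-! ### Weight decompositions and exponentials -/

theorem _root_.CompleteOrthogonalIdempotents.sum_smul_pow {ι B : Type*} [Fintype ι] [Ring B]
    [Algebra ℂ B] {P : ι → B} (hP : CompleteOrthogonalIdempotents P) (a : ι → ℂ) (n : ℕ) :
    (∑ i, a i • P i) ^ n = ∑ i, a i ^ n • P i := by
  classical
  induction n with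
  | zero => simp [hP.complete]
  | succ n ih =>
    rw [pow_succ, ih, Finset.sum_mul]
    refine Finset.sum_congr rfl fun i _ => ?_
    rw [Finset.mul_sum, Finset.sum_eq_single i]
    · rw [smul_mul_smul_comm, hP.idem i, pow_succ]
    · intro k _ hk
      rw [smul_mul_smul_comm, hP.ortho hk.symm, smul_zero]
    · simp

/-- The exponential of a diagonalizable element of a finite-dimensional algebra. -/
theorem _root_.CompleteOrthogonalIdempotents.exp_sum_smul {ι B : Type*} [Fintype ι] [Ring B]
    [Algebra ℂ B] [TopologicalSpace B] [IsModuleTopology ℂ B] [IsTopologicalRing B]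
    {P : ι → B} (hP : CompleteOrthogonalIdempotents P) (a : ι → ℂ) :
    NormedSpace.exp (∑ i, a i • P i) = ∑ i, Complex.exp (a i) • P i := by
  -- linear functionals are continuous and separate points
  have : T2Space B := ⟨fun x y hxy => by
    obtain ⟨g, hg⟩ : ∃ g : B →ₗ[ℂ] ℂ, g x ≠ g y := by
      by_contra! h
      exact hxy (sub_eq_zero.mp ((Module.forall_dual_apply_eq_zero_iff ℂ (x - y)).mp fun g => by
        rw [map_sub, h g, sub_self]))
    exact separated_by_continuous (IsModuleTopology.continuous_of_linearMap g) hg⟩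
  rw [NormedSpace.exp_eq_tsum ℂ]
  refine HasSum.tsum_eq ?_
  simp only [hP.sum_smul_pow, Finset.smul_sum, smul_smul]
  refine hasSum_sum fun i _ => HasSum.smul_const ?_ (P i)
  rw [Complex.exp_eq_exp_ℂ]
  simpa only [smul_eq_mul] using NormedSpace.exp_series_hasSum_exp' (𝕂 := ℂ) (a i)

theorem _root_.CompleteOrthogonalIdempotents.tmul {ι κ B B' : Type*} [Fintype ι] [Fintype κ]
    [Ring B] [Algebra ℂ B] [Ring B'] [Algebra ℂ B'] {P : ι → B} {P' : κ → B'}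
    (hP : CompleteOrthogonalIdempotents P) (hP' : CompleteOrthogonalIdempotents P') :
    CompleteOrthogonalIdempotents fun p : ι × κ => P p.1 ⊗ₜ[ℂ] P' p.2 where
  idem p := by
    rw [IsIdempotentElem, Algebra.TensorProduct.tmul_mul_tmul, hP.idem, hP'.idem]
  ortho p r h := by
    change P p.1 ⊗ₜ[ℂ] P' p.2 * P r.1 ⊗ₜ[ℂ] P' r.2 = 0
    rw [Algebra.TensorProduct.tmul_mul_tmul]
    by_cases h1 : p.1 = r.1
    · have h2 : p.2 ≠ r.2 := fun h2 => h (Prod.ext h1 h2)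
      rw [hP'.ortho h2, TensorProduct.tmul_zero]
    · rw [hP.ortho h1, TensorProduct.zero_tmul]
  complete := by
    rw [Fintype.sum_prod_type]
    simp only [← TensorProduct.tmul_sum, ← TensorProduct.sum_tmul, hP.complete, hP'.complete,
      Algebra.TensorProduct.one_def]

/-- A decomposition of an algebra with a homomorphism `ρ` from `U_q(sl₂)` into weight spaces: `P`
is a complete family of orthogonal idempotents on which `h` acts by the integral weights `μ`, and
`K` by the corresponding powers of `q`. -/
structure IsWeightDecomposition (q : ℂˣ) {B : Type*} [Ring B] [Algebra ℂ B] (ρ : Uq q →ₐ[ℂ] B)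
    (h : B) {ι : Type*} [Fintype ι] (P : ι → B) (μ : ι → ℤ) : Prop where
  complete : CompleteOrthogonalIdempotents P
  h_eq : h = ∑ i, (μ i : ℂ) • P i
  K_mul : ∀ i, ρ (K q) * P i = (q : ℂ) ^ μ i • P i

theorem IsWeightDecomposition.Kpow_eq {q : ℂˣ} {B : Type*} [Ring B] [Algebra ℂ B]
    {ρ : Uq q →ₐ[ℂ] B} {h : B} {ι : Type*} [Fintype ι] {P : ι → B} {μ : ι → ℤ}
    (H : IsWeightDecomposition q ρ h P μ) (j : ℤ) :
    ρ (Kpow q j) = ∑ i, (q : ℂ) ^ (j * μ i) • P i := by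
  have hq := q.ne_zero
  have key (i : ι) : ρ (Kpow q j) * P i = (q : ℂ) ^ (j * μ i) • P i := by
    induction j with
    | zero => simp [Kpow_zero]
    | succ n ih =>
      rw [Kpow_add_one, map_mul, mul_assoc, H.K_mul, mul_smul_comm, ih, smul_smul, add_mul,
        one_mul, zpow_add₀ hq, mul_comm]
    | pred n ih =>
      have h1 : ρ (Kinv q) * P i = (q : ℂ) ^ (-μ i) • P i := by
        have h2 := congrArg (fun x => (q : ℂ) ^ (-μ i) • (ρ (Kinv q) * x)) (H.K_mul i)
        simp only [mul_smul_comm, smul_smul] at h2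
        rw [← mul_assoc, ← map_mul, Kinv_mul_K, map_one, one_mul, ← zpow_add₀ hq,
          neg_add_cancel, zpow_zero, one_smul] at h2
        exact h2.symm
      rw [sub_eq_add_neg, Kpow_add, Kpow_neg_one, map_mul, mul_assoc, h1, mul_smul_comm, ih,
        smul_smul, add_mul, neg_one_mul, zpow_add₀ hq, mul_comm]
  rw [← mul_one (ρ _), ← H.complete.complete, Finset.mul_sum]
  exact Finset.sum_congr rfl fun i _ => key i

/-- If the weights in the first tensor factor are even, the Cartan part `q^{½ H ⊗ H}` of the
R-matrix involves only integral powers of `K` in the second factor. -/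
theorem exp_tmul_eq_map {q : ℂˣ} {lnq : ℂ} (hlnq : Complex.exp lnq = q) {B B' : Type*} [Ring B]
    [Algebra ℂ B] [Ring B'] [Algebra ℂ B'] [TopologicalSpace (B ⊗[ℂ] B')]
    [IsModuleTopology ℂ (B ⊗[ℂ] B')] [IsTopologicalRing (B ⊗[ℂ] B')]
    {ρ : Uq q →ₐ[ℂ] B} {h : B} {ι : Type*} [Fintype ι] {P : ι → B} {μ : ι → ℤ}
    (H : IsWeightDecomposition q ρ h P fun i => 2 * μ i)
    {ρ' : Uq q →ₐ[ℂ] B'} {h' : B'} {κ : Type*} [Fintype κ] {P' : κ → B'} {μ' : κ → ℤ}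
    (H' : IsWeightDecomposition q ρ' h' P' μ') :
    NormedSpace.exp ((lnq / 2) • (h ⊗ₜ[ℂ] h')) =
      Algebra.TensorProduct.map (AlgHom.id ℂ B) ρ' (∑ i, P i ⊗ₜ Kpow q (μ i)) := by
  have e : (lnq / 2) • (h ⊗ₜ[ℂ] h')
      = ∑ p : ι × κ, (lnq * (μ p.1 * μ' p.2 : ℤ)) • (P p.1 ⊗ₜ[ℂ] P' p.2) := by
    rw [H.h_eq, H'.h_eq, TensorProduct.sum_tmul, Finset.smul_sum, Fintype.sum_prod_type]
    refine Finset.sum_congr rfl fun i _ => ?_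
    rw [TensorProduct.tmul_sum, Finset.smul_sum]
    refine Finset.sum_congr rfl fun k _ => ?_
    rw [TensorProduct.smul_tmul_smul, smul_smul]
    congr 1
    push_cast
    ring
  rw [e, (H.complete.tmul H'.complete).exp_sum_smul, map_sum, Fintype.sum_prod_type]
  refine Finset.sum_congr rfl fun i _ => ?_
  rw [Algebra.TensorProduct.map_tmul, H'.Kpow_eq, TensorProduct.tmul_sum]
  refine Finset.sum_congr rfl fun k _ => ?_
  rw [TensorProduct.tmul_smul, ← hlnq, ← Complex.exp_int_mul, mul_comm]
  rfl

/-- If the weights in the first tensor factor are even and `E` acts nilpotently there, then the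
R-matrix is the image of an element of `B ⊗ U_q(sl₂)`. -/
theorem rMatrix_eq_map {q : ℂˣ} {lnq : ℂ} (hlnq : Complex.exp lnq = q) {B B' : Type*} [Ring B]
    [Algebra ℂ B] [Module.Finite ℂ B] [Ring B'] [Algebra ℂ B'] [Module.Finite ℂ B']
    {ρ : Uq q →ₐ[ℂ] B} {h : B} {ι : Type*} [Fintype ι] {P : ι → B} {μ : ι → ℤ}
    (H : IsWeightDecomposition q ρ h P fun i => 2 * μ i) {N : ℕ} (hN : ρ (E q) ^ N = 0)
    {ρ' : Uq q →ₐ[ℂ] B'} {h' : B'} {κ : Type*} [Fintype κ] {P' : κ → B'} {μ' : κ → ℤ}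
    (H' : IsWeightDecomposition q ρ' h' P' μ') :
    rMatrix q lnq h (ρ (E q)) h' (ρ' (F q)) =
      Algebra.TensorProduct.map (AlgHom.id ℂ B) ρ' ((∑ i, P i ⊗ₜ Kpow q (μ i)) *
        ∑ n ∈ Finset.range N, rCoeff q n • (ρ (E q) ^ n) ⊗ₜ (F q ^ n)) := by
  let : TopologicalSpace (B ⊗[ℂ] B') := moduleTopology ℂ (B ⊗[ℂ] B')
  have : IsModuleTopology ℂ (B ⊗[ℂ] B') := ⟨rfl⟩
  have : IsTopologicalRing (B ⊗[ℂ] B') := IsModuleTopology.isTopologicalRing ℂ _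
  rw [map_mul, ← exp_tmul_eq_map hlnq H H', rMatrix]
  congr 1
  rw [finsum_eq_sum_of_support_subset (s := Finset.range N), map_sum]
  · refine Finset.sum_congr rfl fun n _ => ?_
    rw [map_smul, Algebra.TensorProduct.map_tmul, map_pow ρ', ← rCoeff]
    rfl
  · intro n hn
    by_contra h
    rw [Finset.mem_coe, Finset.mem_range, not_lt] at h
    apply hn
    simp only [pow_eq_zero_of_le h hN, TensorProduct.zero_tmul, smul_zero]

theorem rep_gen (q : ℂˣ) (m : ℕ) (x : Gen) : rep q m (gen q x) = repGen q m x := liftGen_gen ..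

theorem isWeightDecomposition_rep (q : ℂˣ) (m : ℕ) :
    IsWeightDecomposition q (rep q m) (hV m) (fun i => Matrix.single i i 1) (wt m) where
  complete :=
    { idem i := by simp [IsIdempotentElem]
      ortho i j h := by simp [h]
      complete := by
        ext a b
        simp [Matrix.sum_apply, Matrix.single_apply, Matrix.one_apply, ite_and] }
  h_eq := by
    ext a b
    simp [hV, Matrix.sum_apply, Matrix.single_apply, Matrix.diagonal_apply, ite_and]
  K_mul i := by
    ext a b
    rw [rep_gen, repGen, Matrix.diagonal_mul, Matrix.smul_apply, Matrix.single_apply]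
    split_ifs with h
    · rw [h.1, smul_eq_mul]
    · simp

/-- The projection of `End V_m` to the span of a matrix unit. -/
def entryProj (m : ℕ) (p : Fin (m + 1) × Fin (m + 1)) : Module.End ℂ (EndV m) :=
  Matrix.singleLinearMap ℂ p.1 p.2 ∘ₗ Matrix.entryLinearMap ℂ ℂ p.1 p.2

theorem entryProj_apply (m : ℕ) (p : Fin (m + 1) × Fin (m + 1)) (A : EndV m) :
    entryProj m p A = Matrix.single p.1 p.2 (A p.1 p.2) := rfl

theorem sum_entryProj (m : ℕ) (A : EndV m) : ∑ p, entryProj m p A = A := by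
  simp only [entryProj_apply, Fintype.sum_prod_type]
  exact (Matrix.matrix_eq_sum_single A).symm

theorem antipodeV_hV (q : ℂˣ) (m : ℕ) : antipodeV q m (hV m) = -hV m := by
  ext i j
  have := antipodeScalar_ne_zero q m i
  by_cases h : i = j
  · subst h; simp [antipodeV, hV, this, wt_rev]
  · simp [antipodeV, hV, h, Ne.symm h]

theorem adHV_apply (q : ℂˣ) (m : ℕ) (A : EndV m) : adHV q m A = hV m * A - A * hV m := by
  have : adHV q m A = hV m * (A * antipodeV q m 1) + 1 * (A * antipodeV q m (hV m)) := by
    rw [adHV, map_add, map_add]; rfl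
  rw [this, antipodeV_one, antipodeV_hV]
  noncomm_ring

/-- Half of the weight of a matrix unit under the adjoint action. -/
def halfWt (m : ℕ) (p : Fin (m + 1) × Fin (m + 1)) : ℤ := (p.2 : ℕ) - (p.1 : ℕ)

theorem isWeightDecomposition_adHom (q : ℂˣ) (m : ℕ) :
    IsWeightDecomposition q (adHom q m) (adHV q m) (entryProj m) (fun p => 2 * halfWt m p) where
  complete :=
    { idem p := LinearMap.ext fun A => by simp [entryProj_apply]
      ortho p r h := LinearMap.ext fun A => by
        have : ¬ (r.1 = p.1 ∧ r.2 = p.2) := fun h' => h (Prod.ext h'.1.symm h'.2.symm)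
        simp [entryProj_apply, this]
      complete := LinearMap.ext fun A => by
        rw [LinearMap.sum_apply, sum_entryProj, Module.End.one_apply] }
  h_eq := LinearMap.ext fun A => by
    rw [adHV_apply, LinearMap.sum_apply]
    ext a b
    rw [Matrix.sum_apply, Finset.sum_eq_single (a, b)]
    · simp [hV, entryProj_apply, halfWt, wt]
      ring
    · intro p _ hp
      have : ¬ (p.1 = a ∧ p.2 = b) := fun h' => hp (Prod.ext h'.1 h'.2)
      simp [entryProj_apply, this]
    · simp
  K_mul p := LinearMap.ext fun A => by
    rw [Module.End.mul_apply, adHom_apply, adV_K, LinearMap.smul_apply, entryProj_apply]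
    ext a b
    rw [rep_gen, rep_gen, repGen, repGen, Matrix.mul_diagonal, Matrix.diagonal_mul,
      Matrix.smul_apply, Matrix.single_apply]
    split_ifs with h
    · have : 2 * halfWt m p = wt m a + -wt m b := by
        simp only [halfWt, wt, h.1, h.2]; ring
      rw [this, zpow_add₀ q.ne_zero, smul_eq_mul]
      ring
    · simp

/-! ### Weight spaces of the adjoint representation -/

/-- The space of matrices of weight `2 j` for the adjoint action on `End V_m`. -/
def weightSpace (q : ℂˣ) (m : ℕ) (j : ℤ) : Submodule ℂ (EndV m) where
  carrier := {A | rep q m (K q) * A = (q : ℂ) ^ (2 * j) • (A * rep q m (K q))}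
  zero_mem' := by simp
  add_mem' {A B} hA hB := by
    rw [Set.mem_ofPred_eq] at *
    rw [mul_add, hA, hB, add_mul, smul_add]
  smul_mem' c A hA := by
    rw [Set.mem_ofPred_eq] at *
    rw [mul_smul_comm, hA, smul_mul_assoc, smul_comm]

theorem mem_weightSpace {q : ℂˣ} {m : ℕ} {j : ℤ} {A : EndV m} : A ∈ weightSpace q m j ↔
    rep q m (K q) * A = (q : ℂ) ^ (2 * j) • (A * rep q m (K q)) := Iff.rfl

theorem rep_K_mul_apply (q : ℂˣ) (m : ℕ) (A : EndV m) (a b : Fin (m + 1)) :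
    (rep q m (K q) * A) a b = (q : ℂ) ^ wt m a * A a b := by
  rw [rep_gen, repGen, Matrix.diagonal_mul]

theorem mul_rep_K_apply (q : ℂˣ) (m : ℕ) (A : EndV m) (a b : Fin (m + 1)) :
    (A * rep q m (K q)) a b = A a b * (q : ℂ) ^ wt m b := by
  rw [rep_gen, repGen, Matrix.mul_diagonal]

theorem single_mem_weightSpace (q : ℂˣ) (m : ℕ) (a b : Fin (m + 1)) (c : ℂ) :
    Matrix.single a b c ∈ weightSpace q m ((b : ℕ) - (a : ℕ)) := by
  rw [mem_weightSpace]
  ext i j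
  rw [rep_K_mul_apply, Matrix.smul_apply, mul_rep_K_apply, Matrix.single_apply]
  split_ifs with h
  · have : wt m i = 2 * ((b : ℕ) - (a : ℕ)) + wt m j := by
      simp only [wt, h.1, h.2]; ring
    rw [this, zpow_add₀ q.ne_zero, smul_eq_mul]
    ring
  · simp

theorem eq_of_mem_weightSpace {q : ℂˣ} (hq : ∀ n : ℕ, 0 < n → q ^ n ≠ 1) {m : ℕ} {j : ℤ}
    {A : EndV m} (hA : A ∈ weightSpace q m j) {a b : Fin (m + 1)} (hab : A a b ≠ 0) :
    j = (b : ℕ) - (a : ℕ) := by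
  have h := congrFun (congrFun (mem_weightSpace.mp hA) a) b
  rw [rep_K_mul_apply, Matrix.smul_apply, mul_rep_K_apply, smul_eq_mul, mul_left_comm,
    mul_comm, mul_right_inj' hab, ← zpow_add₀ q.ne_zero] at h
  have := zpow_injective hq h
  simp only [wt] at this
  omega

theorem eq_zero_of_mem_weightSpace {q : ℂˣ} (hq : ∀ n : ℕ, 0 < n → q ^ n ≠ 1) {m : ℕ} {j : ℤ}
    {A : EndV m} (hA : A ∈ weightSpace q m j) (hj : j < -m ∨ m < j) : A = 0 := by
  ext a b
  by_contra hab
  have := eq_of_mem_weightSpace hq hA hab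
  omega

/-- Linear maps on `End V_m` are determined by their values on weight vectors. -/
theorem linearMap_ext_weightSpace {q : ℂˣ} {m : ℕ} {M : Type*} [AddCommGroup M] [Module ℂ M]
    {f g : EndV m →ₗ[ℂ] M} (h : ∀ j, ∀ A ∈ weightSpace q m j, f A = g A) : f = g := by
  refine LinearMap.ext fun A => ?_
  rw [← sum_entryProj m A, map_sum, map_sum]
  exact Finset.sum_congr rfl fun p _ => h _ _ (single_mem_weightSpace q m _ _ _)

theorem mul_mem_weightSpace {q : ℂˣ} {m : ℕ} {i j : ℤ} {A B : EndV m}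
    (hA : A ∈ weightSpace q m i) (hB : B ∈ weightSpace q m j) :
    A * B ∈ weightSpace q m (i + j) := by
  rw [mem_weightSpace] at *
  rw [← mul_assoc, hA, smul_mul_assoc, mul_assoc, hB, mul_smul_comm, smul_smul, mul_add,
    zpow_add₀ q.ne_zero, mul_assoc]

theorem rep_E_mem_weightSpace (q : ℂˣ) (m : ℕ) : rep q m (E q) ∈ weightSpace q m 1 := by
  rw [mem_weightSpace, ← map_mul, K_mul_E, map_smul, map_mul]
  norm_cast

theorem rep_F_mem_weightSpace (q : ℂˣ) (m : ℕ) : rep q m (F q) ∈ weightSpace q m (-1) := by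
  rw [mem_weightSpace, ← map_mul, K_mul_F, map_smul, map_mul]
  norm_num

theorem rep_Kpow_mem_weightSpace (q : ℂˣ) (m : ℕ) (j : ℤ) :
    rep q m (Kpow q j) ∈ weightSpace q m 0 := by
  rw [mem_weightSpace, ← map_mul, ← map_mul, K_mul_Kpow, Kpow_add_one]
  simp

theorem rep_F_pow_mem_weightSpace (q : ℂˣ) (m : ℕ) (n : ℕ) :
    rep q m (F q ^ n) ∈ weightSpace q m (-n) := by
  induction n with
  | zero => simpa [Kpow_zero] using rep_Kpow_mem_weightSpace q m 0
  | succ n ih =>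
    rw [pow_succ, map_mul]
    have := mul_mem_weightSpace ih (rep_F_mem_weightSpace q m)
    rwa [← neg_add, ← Nat.cast_succ] at this

theorem rep_K_conj_of_mem {q : ℂˣ} {m : ℕ} {j : ℤ} {A : EndV m} (hA : A ∈ weightSpace q m j) :
    rep q m (K q) * A * rep q m (Kinv q) = (q : ℂ) ^ (2 * j) • A := by
  rw [mem_weightSpace.mp hA, smul_mul_assoc, mul_assoc, ← map_mul, K_mul_Kinv, map_one, mul_one]

theorem antipodeV_mem_weightSpace {q : ℂˣ} {m : ℕ} {j : ℤ} {A : EndV m}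
    (hA : A ∈ weightSpace q m j) : antipodeV q m A ∈ weightSpace q m j := by
  have h := congrArg (fun x => antipodeV q m x * rep q m (K q)) (rep_K_conj_of_mem hA)
  simp only [antipodeV_mul, antipodeV_rep, antipode_K, antipode_Kinv, map_smul,
    smul_mul_assoc] at h
  rw [mul_assoc, mul_assoc, ← map_mul, Kinv_mul_K, map_one, mul_one] at h
  exact h

theorem adV_E_mem_weightSpace {q : ℂˣ} {m : ℕ} {j : ℤ} {A : EndV m}
    (hA : A ∈ weightSpace q m j) : adV q m (E q) A ∈ weightSpace q m (j + 1) := by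
  rw [adV_E]
  have h1 := mul_mem_weightSpace (rep_E_mem_weightSpace q m) hA
  rw [add_comm 1 j] at h1
  have h2 := mul_mem_weightSpace hA (rep_E_mem_weightSpace q m)
  have h3 := mul_mem_weightSpace (sub_mem h1 h2) (rep_Kpow_mem_weightSpace q m (-1))
  rwa [add_zero, Kpow_neg_one] at h3

theorem adV_E_pow_mem_weightSpace {q : ℂˣ} {m : ℕ} {j : ℤ} {A : EndV m}
    (hA : A ∈ weightSpace q m j) (n : ℕ) :
    (adV q m (E q) ^ n) A ∈ weightSpace q m (j + n) := by
  induction n with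
  | zero => simpa using hA
  | succ n ih =>
    rw [pow_succ', Module.End.mul_apply, Nat.cast_succ, ← add_assoc]
    exact adV_E_mem_weightSpace ih

theorem adV_E_pow_eq_zero {q : ℂˣ} (hq : ∀ n : ℕ, 0 < n → q ^ n ≠ 1) (m : ℕ) :
    adV q m (E q) ^ (2 * m + 1) = 0 := by
  refine linearMap_ext_weightSpace (q := q) fun j A hA => ?_
  rw [LinearMap.zero_apply]
  by_cases hj : j < -m
  · rw [eq_zero_of_mem_weightSpace hq hA (.inl hj), map_zero]
  · refine eq_zero_of_mem_weightSpace hq (adV_E_pow_mem_weightSpace hA _) (.inr ?_)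
    push_cast
    omega

/-! ### The R-matrix as a coaction -/

/-- The R-matrix with values in `End (End V_m) ⊗ U_q(sl₂)`: its first factor acts on `End V_m` by
the adjoint action. It is a finite sum without half-integral powers of `q^H`, because the weights
of the adjoint action are even and bounded. -/
def adR (q : ℂˣ) (m : ℕ) : Module.End ℂ (EndV m) ⊗[ℂ] Uq q :=
  (∑ p, entryProj m p ⊗ₜ Kpow q (halfWt m p)) *
    ∑ n ∈ Finset.range (2 * m + 1), rCoeff q n • (adV q m (E q) ^ n) ⊗ₜ (F q ^ n)

/-- The map `A ↦ ∑ R₁ ▷ A ⊗ R₂` from `End V_m` to `End V_m ⊗ U_q(sl₂)`. -/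
def coact (q : ℂˣ) (m : ℕ) : EndV m →ₗ[ℂ] EndV m ⊗[ℂ] Uq q where
  toFun A := TensorProduct.map (LinearMap.applyₗ A) LinearMap.id (adR q m)
  map_add' A B := by rw [map_add, TensorProduct.map_add_left]; rfl
  map_smul' c A := by rw [map_smul, TensorProduct.map_smul_left]; rfl

theorem coact_apply (q : ℂˣ) (m : ℕ) (A : EndV m) :
    coact q m A = TensorProduct.map (LinearMap.applyₗ A) LinearMap.id (adR q m) := rfl

theorem sum_entryProj_tmul {q : ℂˣ} (hq : ∀ n : ℕ, 0 < n → q ^ n ≠ 1) {m : ℕ} {j : ℤ}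
    {A : EndV m} (hA : A ∈ weightSpace q m j) (x : Uq q) :
    ∑ p, entryProj m p A ⊗ₜ[ℂ] (Kpow q (halfWt m p) * x) = A ⊗ₜ[ℂ] (Kpow q j * x) := by
  rw [show A ⊗ₜ[ℂ] (Kpow q j * x) = (∑ p, entryProj m p A) ⊗ₜ[ℂ] (Kpow q j * x) by
    rw [sum_entryProj], TensorProduct.sum_tmul]
  refine Finset.sum_congr rfl fun p _ => ?_
  by_cases h : A p.1 p.2 = 0
  · rw [entryProj_apply, h, Matrix.single_zero, TensorProduct.zero_tmul, TensorProduct.zero_tmul]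
  · rw [eq_of_mem_weightSpace hq hA h, halfWt]

theorem coact_of_mem {q : ℂˣ} (hq : ∀ n : ℕ, 0 < n → q ^ n ≠ 1) {m : ℕ} {j : ℤ}
    {A : EndV m} (hA : A ∈ weightSpace q m j) :
    coact q m A = ∑ n ∈ Finset.range (2 * m + 1),
      rCoeff q n • (adV q m (E q) ^ n) A ⊗ₜ[ℂ] (Kpow q (j + n) * F q ^ n) := by
  rw [coact_apply, adR, Finset.mul_sum, map_sum]
  refine Finset.sum_congr rfl fun n _ => ?_
  rw [mul_smul_comm, map_smul, ← sum_entryProj_tmul hq (adV_E_pow_mem_weightSpace hA n),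
    Finset.sum_mul, map_sum]
  simp only [Algebra.TensorProduct.tmul_mul_tmul]
  rfl

/-- The range of summation may be enlarged, as the additional terms vanish. -/
theorem coact_of_mem_of_le {q : ℂˣ} (hq : ∀ n : ℕ, 0 < n → q ^ n ≠ 1) {m : ℕ} {j : ℤ}
    {A : EndV m} (hA : A ∈ weightSpace q m j) {N : ℕ} (hN : 2 * m + 1 ≤ N) :
    coact q m A = ∑ n ∈ Finset.range N,
      rCoeff q n • (adV q m (E q) ^ n) A ⊗ₜ[ℂ] (Kpow q (j + n) * F q ^ n) := by
  rw [coact_of_mem hq hA]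
  refine Finset.sum_subset (Finset.range_mono hN) fun n _ hn => ?_
  rw [Finset.mem_range, not_lt] at hn
  rw [pow_eq_zero_of_le hn (adV_E_pow_eq_zero hq m), LinearMap.zero_apply,
    TensorProduct.zero_tmul, smul_zero]

/-- The rearrangement `(w ⊗ x) ⊗ s ↦ w ⊗ (s ⊗ x)`. -/
def swapRight (q : ℂˣ) (m : ℕ) : (EndV m ⊗[ℂ] Uq q) ⊗[ℂ] Uq q →ₗ[ℂ] EndV m ⊗[ℂ] (Uq q ⊗[ℂ] Uq q) :=
  TensorProduct.map LinearMap.id (TensorProduct.comm ℂ (Uq q) (Uq q)).toLinearMap ∘ₗ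
    (TensorProduct.assoc ℂ (EndV m) (Uq q) (Uq q)).toLinearMap

@[simp]
theorem swapRight_tmul (q : ℂˣ) (m : ℕ) (w : EndV m) (x s : Uq q) :
    swapRight q m ((w ⊗ₜ x) ⊗ₜ s) = w ⊗ₜ (s ⊗ₜ x) := rfl

/-- The term of `(Id ⊗ Δ)(R)` of degree `N`, by the `q`-binomial theorem. -/
theorem rCoeff_smul_comul_Kpow_mul_F_pow {q : ℂˣ} (hq : ∀ n : ℕ, 0 < n → q ^ n ≠ 1) (j : ℤ)
    (N : ℕ) : rCoeff q N • comul q (Kpow q (j + N) * F q ^ N) =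
      ∑ p ∈ Finset.HasAntidiagonal.antidiagonal N, (rCoeff q p.1 * rCoeff q p.2) •
        (Kpow q (j + p.1) * F q ^ p.1) ⊗ₜ[ℂ] (Kpow q (j + p.1 + p.2) * F q ^ p.2) := by
  have hxy : (F q ⊗ₜ[ℂ] (1 : Uq q)) * (Kinv q ⊗ₜ[ℂ] F q)
      = qInvSq q • ((Kinv q ⊗ₜ[ℂ] F q) * (F q ⊗ₜ[ℂ] (1 : Uq q))) := by
    rw [Algebra.TensorProduct.tmul_mul_tmul, Algebra.TensorProduct.tmul_mul_tmul, F_mul_Kinv,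
      one_mul, mul_one, ← TensorProduct.smul_tmul', qInvSq]
  have hpow (n : ℕ) : Kinv q ^ n = Kpow q (-n) := by
    induction n with
    | zero => simp [Kpow_zero]
    | succ n ih => rw [pow_succ, ih, ← Kpow_neg_one, ← Kpow_add]; congr 1; push_cast; ring
  rw [map_mul, map_pow, comul_Kpow, comul_F, ← mul_smul_comm, rCoeff_smul_add_pow hq hxy,
    Finset.mul_sum]
  refine Finset.sum_congr rfl fun p hp => ?_
  have hp' : (p.1 : ℤ) + p.2 = N := by exact_mod_cast Finset.HasAntidiagonal.mem_antidiagonal.mp hp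
  rw [mul_smul_comm, Algebra.TensorProduct.tmul_pow, Algebra.TensorProduct.tmul_pow, one_pow,
    Algebra.TensorProduct.tmul_mul_tmul, Algebra.TensorProduct.tmul_mul_tmul, mul_one, hpow,
    ← mul_assoc, ← Kpow_add, ← hp', show j + ((p.1 : ℤ) + p.2) + -p.2 = j + p.1 by ring,
    ← add_assoc]

/-- The identity `(Id ⊗ Δ)(R) = R₁₃ R₁₂`: the map `A ↦ ∑ R₁ ▷ A ⊗ R₂` is a coaction for the
opposite coproduct. -/
theorem map_comul_coact {q : ℂˣ} (hq : ∀ n : ℕ, 0 < n → q ^ n ≠ 1) {m : ℕ} (A : EndV m) :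
    TensorProduct.map LinearMap.id (comul q).toLinearMap (coact q m A) =
      swapRight q m (TensorProduct.map (coact q m) LinearMap.id (coact q m A)) := by
  revert A
  suffices h : TensorProduct.map LinearMap.id (comul q).toLinearMap ∘ₗ coact q m =
      swapRight q m ∘ₗ TensorProduct.map (coact q m) LinearMap.id ∘ₗ coact q m from
    fun A => LinearMap.congr_fun h A
  refine linearMap_ext_weightSpace (q := q) fun j A hA => ?_
  simp only [LinearMap.comp_apply]
  rw [coact_of_mem hq hA, map_sum, map_sum, map_sum]
  set M := 2 * m + 1 with hM
  let g (n k : ℕ) : EndV m ⊗[ℂ] (Uq q ⊗[ℂ] Uq q) :=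
    (rCoeff q n * rCoeff q k) • (adV q m (E q) ^ (n + k)) A ⊗ₜ[ℂ]
      ((Kpow q (j + n) * F q ^ n) ⊗ₜ[ℂ] (Kpow q (j + n + k) * F q ^ k))
  have hl (N : ℕ) : TensorProduct.map LinearMap.id (comul q).toLinearMap
      (rCoeff q N • (adV q m (E q) ^ N) A ⊗ₜ[ℂ] (Kpow q (j + N) * F q ^ N))
      = ∑ k ∈ Finset.range (N + 1), g k (N - k) := by
    rw [map_smul, TensorProduct.map_tmul, ← TensorProduct.tmul_smul, AlgHom.toLinearMap_apply,
      rCoeff_smul_comul_Kpow_mul_F_pow hq, TensorProduct.tmul_sum,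
      ← Finset.Nat.sum_antidiagonal_eq_sum_range_succ g]
    refine Finset.sum_congr rfl fun p hp => ?_
    rw [← Finset.HasAntidiagonal.mem_antidiagonal.mp hp, TensorProduct.tmul_smul]
    rfl
  have hr (n : ℕ) : swapRight q m (TensorProduct.map (coact q m) LinearMap.id
      (rCoeff q n • (adV q m (E q) ^ n) A ⊗ₜ[ℂ] (Kpow q (j + n) * F q ^ n)))
      = ∑ k ∈ Finset.range M, g n k := by
    rw [map_smul, TensorProduct.map_tmul, coact_of_mem hq (adV_E_pow_mem_weightSpace hA n),
      TensorProduct.sum_tmul, map_smul, map_sum, Finset.smul_sum]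
    refine Finset.sum_congr rfl fun k _ => ?_
    rw [← TensorProduct.smul_tmul', map_smul, LinearMap.id_apply, swapRight_tmul, smul_smul,
      ← Module.End.mul_apply, ← pow_add, add_comm k n]
  simp only [hl, hr]
  rw [Finset.sum_range_diag_flip M g]
  refine Finset.sum_congr rfl fun n _ => Finset.sum_subset (Finset.range_mono (by omega)) ?_
  intro k _ hk
  have : M ≤ n + k := by rw [Finset.mem_range] at hk; omega
  simp only [g]
  rw [pow_eq_zero_of_le this (adV_E_pow_eq_zero hq m), LinearMap.zero_apply,
    TensorProduct.zero_tmul, smul_zero]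

/-- The identity `(Id ⊗ ε)(R) = 1`. -/
theorem map_counit_coact {q : ℂˣ} (hq : ∀ n : ℕ, 0 < n → q ^ n ≠ 1) {m : ℕ} (A : EndV m) :
    TensorProduct.rid ℂ (EndV m)
      (TensorProduct.map LinearMap.id (counit q).toLinearMap (coact q m A)) = A := by
  revert A
  suffices h : (TensorProduct.rid ℂ (EndV m)).toLinearMap ∘ₗ
      TensorProduct.map LinearMap.id (counit q).toLinearMap ∘ₗ coact q m = LinearMap.id from
    fun A => LinearMap.congr_fun h A
  refine linearMap_ext_weightSpace (q := q) fun j A hA => ?_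
  simp only [LinearMap.comp_apply, LinearEquiv.coe_coe]
  rw [coact_of_mem hq hA, map_sum, map_sum, Finset.sum_range_succ', Finset.sum_eq_zero]
  · simp [counit_Kpow, rCoeff_zero]
  · intro n _
    simp [counit_F]

/-- The identity `R Δ(E) = Δᵒᵖ(E) R`. -/
theorem coact_adV_E {q : ℂˣ} (hq : ∀ n : ℕ, 0 < n → q ^ n ≠ 1) {m : ℕ} (A : EndV m) :
    TensorProduct.map LinearMap.id (LinearMap.mulRight ℂ (K q)) (coact q m (adV q m (E q) A)) +
      TensorProduct.map LinearMap.id (LinearMap.mulRight ℂ (E q)) (coact q m A) =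
    TensorProduct.map (adV q m (K q)) (LinearMap.mulLeft ℂ (E q)) (coact q m A) +
      TensorProduct.map (adV q m (E q)) LinearMap.id (coact q m A) := by
  revert A
  suffices h : TensorProduct.map LinearMap.id (LinearMap.mulRight ℂ (K q)) ∘ₗ
        coact q m ∘ₗ adV q m (E q) +
      TensorProduct.map LinearMap.id (LinearMap.mulRight ℂ (E q)) ∘ₗ coact q m =
    TensorProduct.map (adV q m (K q)) (LinearMap.mulLeft ℂ (E q)) ∘ₗ coact q m +
      TensorProduct.map (adV q m (E q)) LinearMap.id ∘ₗ coact q m from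
    fun A => LinearMap.congr_fun h A
  refine linearMap_ext_weightSpace (q := q) fun j A hA => ?_
  simp only [LinearMap.comp_apply, LinearMap.add_apply]
  rw [coact_of_mem hq (adV_E_mem_weightSpace hA)]
  -- the terms that contain the commutator of `E` and `Fⁿ` are summed over one more index
  nth_rw 3 [coact_of_mem hq hA]
  rw [coact_of_mem_of_le hq hA (N := 2 * m + 1 + 1) (by omega)]
  have hK (n : ℕ) : adV q m (K q) ((adV q m (E q) ^ n) A) ⊗ₜ[ℂ] (E q * (Kpow q (j + n) * F q ^ n))
      = (adV q m (E q) ^ n) A ⊗ₜ[ℂ] (Kpow q (j + n) * (E q * F q ^ n)) := by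
    rw [adV_K, rep_K_conj_of_mem (adV_E_pow_mem_weightSpace hA n), ← mul_assoc, E_mul_Kpow,
      smul_mul_assoc, TensorProduct.smul_tmul_smul, zpow_mul, ← mul_zpow]
    rw [show (q : ℂ) ^ (2 : ℤ) = (q : ℂ) ^ 2 by norm_cast, sq_mul_qInvSq, one_zpow, one_smul,
      mul_assoc]
  simp only [map_sum, map_smul, TensorProduct.map_tmul, LinearMap.id_apply,
    LinearMap.mulRight_apply, LinearMap.mulLeft_apply, hK]
  have hc (n : ℕ) (v : EndV m) (x : Uq q) : rCoeff q (n + 1) • v ⊗ₜ[ℂ] (x * (E q * F q ^ (n + 1)))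
      = v ⊗ₜ[ℂ] (x * (rCoeff q (n + 1) • (F q ^ (n + 1) * E q) +
        rCoeff q n • (F q ^ n * K q - Kinv q * F q ^ n))) := by
    rw [← TensorProduct.tmul_smul, ← mul_smul_comm, rCoeff_smul_E_mul_F_pow hq]
  rw [Finset.sum_range_succ' _ (2 * m + 1), Finset.sum_range_succ' _ (2 * m + 1)]
  simp only [hc]
  rw [← add_assoc, ← Finset.sum_add_distrib, add_right_comm, ← Finset.sum_add_distrib]
  congr 1
  · refine Finset.sum_congr rfl fun n _ => ?_
    have e1 : (adV q m (E q) ^ n) (adV q m (E q) A) = (adV q m (E q) ^ (n + 1)) A := by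
      rw [pow_succ, Module.End.mul_apply]
    have e2 : adV q m (E q) ((adV q m (E q) ^ n) A) = (adV q m (E q) ^ (n + 1)) A := by
      rw [pow_succ', Module.End.mul_apply]
    have e3 : j + 1 + (n : ℤ) = j + (n + 1 : ℕ) := by push_cast; ring
    have e4 : Kpow q (j + (n + 1 : ℕ)) * (Kinv q * F q ^ n) = Kpow q (j + n) * F q ^ n := by
      rw [← mul_assoc, ← Kpow_neg_one, ← Kpow_add]
      congr 2
      push_cast; ring
    rw [e1, e2, e3]
    simp only [mul_add, mul_smul_comm, mul_sub, e4, smul_sub, mul_assoc, TensorProduct.tmul_add,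
      TensorProduct.tmul_sub, TensorProduct.tmul_smul]
    abel
  · simp

/-! ### The braided antipode -/

/-- The linear map `w ⊗ s ↦ s S(w)`. -/
def mulAntipode (q : ℂˣ) (m : ℕ) : EndV m ⊗[ℂ] Uq q →ₗ[ℂ] EndV m :=
  LinearMap.mul' ℂ (EndV m) ∘ₗ TensorProduct.map (rep q m).toLinearMap (antipodeV q m) ∘ₗ
    (TensorProduct.comm ℂ (EndV m) (Uq q)).toLinearMap

@[simp]
theorem mulAntipode_tmul (q : ℂˣ) (m : ℕ) (w : EndV m) (s : Uq q) :
    mulAntipode q m (w ⊗ₜ s) = rep q m s * antipodeV q m w := rfl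

/-- The braided antipode `A ↦ ∑ R₂ S(R₁ ▷ A)`, through the coaction. -/
def coactAntipode (q : ℂˣ) (m : ℕ) : Module.End ℂ (EndV m) := mulAntipode q m ∘ₗ coact q m

theorem coactAntipode_apply (q : ℂˣ) (m : ℕ) (A : EndV m) :
    coactAntipode q m A = mulAntipode q m (coact q m A) := rfl

theorem coactAntipode_mem_weightSpace {q : ℂˣ} (hq : ∀ n : ℕ, 0 < n → q ^ n ≠ 1) {m : ℕ} {j : ℤ}
    {A : EndV m} (hA : A ∈ weightSpace q m j) : coactAntipode q m A ∈ weightSpace q m j := by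
  rw [coactAntipode_apply, coact_of_mem hq hA, map_sum]
  refine sum_mem fun n _ => ?_
  rw [map_smul, mulAntipode_tmul, map_mul]
  refine Submodule.smul_mem _ _ ?_
  have h1 := mul_mem_weightSpace (rep_Kpow_mem_weightSpace q m (j + n))
    (rep_F_pow_mem_weightSpace q m n)
  have h2 := mul_mem_weightSpace h1 (antipodeV_mem_weightSpace (adV_E_pow_mem_weightSpace hA n))
  have e : 0 + -(n : ℤ) + (j + n) = j := by ring
  rwa [e] at h2

/-- The braided antipode commutes with the adjoint action of `E`. -/
theorem coactAntipode_adV_E {q : ℂˣ} (hq : ∀ n : ℕ, 0 < n → q ^ n ≠ 1) {m : ℕ} (A : EndV m) :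
    coactAntipode q m (adV q m (E q) A) = adV q m (E q) (coactAntipode q m A) := by
  have hK : rep q m (K q) * rep q m (Kinv q) = 1 := by rw [← map_mul, K_mul_Kinv, map_one]
  have hK' : rep q m (Kinv q) * rep q m (K q) = 1 := by rw [← map_mul, Kinv_mul_K, map_one]
  have SK : antipodeV q m (rep q m (K q)) = rep q m (Kinv q) := by rw [antipodeV_rep, antipode_K]
  have SKinv : antipodeV q m (rep q m (Kinv q)) = rep q m (K q) := by
    rw [antipodeV_rep, antipode_Kinv]
  have SE : antipodeV q m (rep q m (E q)) = -(rep q m (E q) * rep q m (Kinv q)) := by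
    rw [antipodeV_rep, antipode_E, map_neg, map_mul]
  -- the linear map `w ⊗ s ↦ s K⁻¹ S(w)`
  let Θ : EndV m ⊗[ℂ] Uq q →ₗ[ℂ] EndV m :=
    mulAntipode q m ∘ₗ TensorProduct.map LinearMap.id (LinearMap.mulRight ℂ (Kinv q))
  have hΘ (w : EndV m) (s : Uq q) :
      Θ (w ⊗ₜ s) = rep q m s * rep q m (Kinv q) * antipodeV q m w := by
    rw [← map_mul]; rfl
  have h1 (z : EndV m ⊗[ℂ] Uq q) : Θ (TensorProduct.map LinearMap.id
      (LinearMap.mulRight ℂ (K q)) z) = mulAntipode q m z := by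
    induction z with
    | zero => simp
    | tmul w s =>
      rw [TensorProduct.map_tmul, LinearMap.id_apply, LinearMap.mulRight_apply, hΘ,
        map_mul, mul_assoc (rep q m s), hK, mul_one, mulAntipode_tmul]
    | add a b ha hb => simp only [map_add, ha, hb]
  have h2 (z : EndV m ⊗[ℂ] Uq q) : Θ (TensorProduct.map (adV q m (K q))
      (LinearMap.mulLeft ℂ (E q)) z)
        = rep q m (E q) * mulAntipode q m z * rep q m (Kinv q) := by
    induction z with
    | zero => simp
    | tmul w s =>
      rw [TensorProduct.map_tmul, LinearMap.mulLeft_apply, hΘ, adV_K, antipodeV_mul,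
        antipodeV_mul, SK, SKinv, map_mul, mulAntipode_tmul]
      simp only [mul_assoc]
      rw [← mul_assoc (rep q m (Kinv q)), hK', one_mul]
    | add a b ha hb => simp only [map_add, ha, hb, mul_add, add_mul]
  have h3 (z : EndV m ⊗[ℂ] Uq q) : Θ (TensorProduct.map (adV q m (E q)) LinearMap.id z)
        = -(mulAntipode q m z * rep q m (E q) * rep q m (Kinv q)) +
          Θ (TensorProduct.map LinearMap.id (LinearMap.mulRight ℂ (E q)) z) := by
    induction z with
    | zero => simp
    | tmul w s =>
      rw [TensorProduct.map_tmul, TensorProduct.map_tmul, LinearMap.id_apply, LinearMap.id_apply,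
        LinearMap.mulRight_apply, hΘ, hΘ, adV_E, antipodeV_mul, map_sub, antipodeV_mul,
        antipodeV_mul, SE, SKinv, map_mul, mulAntipode_tmul]
      simp only [mul_assoc, mul_sub, mul_neg, neg_mul]
      rw [← mul_assoc (rep q m (Kinv q)), hK', one_mul, ← mul_assoc (rep q m (Kinv q)), hK',
        one_mul, sub_neg_eq_add]
    | add a b ha hb =>
      simp only [map_add, ha, hb, add_mul]
      abel
  have h := congrArg Θ (coact_adV_E hq A)
  rw [map_add, map_add, h1, h2, h3, ← add_assoc] at h
  rw [coactAntipode_apply, coactAntipode_apply, add_right_cancel h, adV_E]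
  noncomm_ring

/-- The braided antipode commutes with the coaction, as it commutes with the action of `E` and
preserves weights. -/
theorem coact_coactAntipode {q : ℂˣ} (hq : ∀ n : ℕ, 0 < n → q ^ n ≠ 1) {m : ℕ} (A : EndV m) :
    coact q m (coactAntipode q m A) =
      TensorProduct.map (coactAntipode q m) LinearMap.id (coact q m A) := by
  revert A
  suffices h : coact q m ∘ₗ coactAntipode q m =
      TensorProduct.map (coactAntipode q m) LinearMap.id ∘ₗ coact q m from
    fun A => LinearMap.congr_fun h A
  refine linearMap_ext_weightSpace (q := q) fun j A hA => ?_
  simp only [LinearMap.comp_apply]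
  have hpow (n : ℕ) : (adV q m (E q) ^ n) (coactAntipode q m A)
      = coactAntipode q m ((adV q m (E q) ^ n) A) := by
    induction n with
    | zero => simp
    | succ n ih =>
      rw [pow_succ', Module.End.mul_apply, ih, ← coactAntipode_adV_E hq, Module.End.mul_apply]
  rw [coact_of_mem hq hA, coact_of_mem hq (coactAntipode_mem_weightSpace hq hA), map_sum]
  refine Finset.sum_congr rfl fun n _ => ?_
  rw [map_smul, TensorProduct.map_tmul, hpow, LinearMap.id_apply]

/-- The identity `∑ S(R₂) S̲(R₁ ▷ A) = S(A)`, which inverts the definition of the braided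
antipode. -/
theorem sum_antipode_mul_coactAntipode {q : ℂˣ} (hq : ∀ n : ℕ, 0 < n → q ^ n ≠ 1) {m : ℕ}
    (A : EndV m) : LinearMap.mul' ℂ (EndV m) (TensorProduct.comm ℂ (EndV m) (EndV m)
      (TensorProduct.map (coactAntipode q m) ((rep q m).toLinearMap ∘ₗ antipode q)
        (coact q m A))) = antipodeV q m A := by
  -- the linear map `w ⊗ (s ⊗ x) ↦ S(s) x S(w)`
  let Φ : EndV m ⊗[ℂ] (Uq q ⊗[ℂ] Uq q) →ₗ[ℂ] EndV m :=
    mulAntipode q m ∘ₗ TensorProduct.map LinearMap.id (antipodeMul q)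
  have hΦ (w : EndV m) (s x : Uq q) : Φ (w ⊗ₜ (s ⊗ₜ x))
      = rep q m (antipode q s) * mulAntipode q m (w ⊗ₜ x) := by
    rw [mulAntipode_tmul, ← mul_assoc, ← map_mul]; rfl
  have h1 (z : EndV m ⊗[ℂ] Uq q) :
      Φ (swapRight q m (TensorProduct.map (coact q m) LinearMap.id z)) =
        LinearMap.mul' ℂ (EndV m) (TensorProduct.comm ℂ (EndV m) (EndV m)
          (TensorProduct.map (coactAntipode q m) ((rep q m).toLinearMap ∘ₗ antipode q) z)) := by
    induction z with
    | zero => simp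
    | add a b ha hb => simp only [map_add, ha, hb]
    | tmul w s =>
      have h (y : EndV m ⊗[ℂ] Uq q) :
          Φ (swapRight q m (y ⊗ₜ s)) = rep q m (antipode q s) * mulAntipode q m y := by
        induction y with
        | zero => simp
        | add a b ha hb => simp only [TensorProduct.add_tmul, map_add, ha, hb, mul_add]
        | tmul v x => rw [swapRight_tmul, hΦ]
      exact h _
  have h2 (z : EndV m ⊗[ℂ] Uq q) :
      Φ (TensorProduct.map LinearMap.id (comul q).toLinearMap z) = antipodeV q m
        (TensorProduct.rid ℂ (EndV m)
          (TensorProduct.map LinearMap.id (counit q).toLinearMap z)) := by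
    induction z with
    | zero => simp
    | add a b ha hb => simp only [map_add, ha, hb]
    | tmul w s =>
      have : Φ (w ⊗ₜ comul q s) = mulAntipode q m (w ⊗ₜ antipodeMul q (comul q s)) := rfl
      rw [TensorProduct.map_tmul, LinearMap.id_apply, AlgHom.toLinearMap_apply, this,
        antipodeMul_comul, mulAntipode_tmul]
      simp
  rw [← h1, ← map_comul_coact hq, h2, map_counit_coact hq]

/-- The linear map `w ⊗ s ↦ (s ▷ X) w`. -/
def adMul (q : ℂˣ) (m : ℕ) (X : EndV m) : EndV m ⊗[ℂ] Uq q →ₗ[ℂ] EndV m :=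
  LinearMap.mul' ℂ (EndV m) ∘ₗ
    TensorProduct.map ((adHom q m).toLinearMap.flip X) LinearMap.id ∘ₗ
    (TensorProduct.comm ℂ (EndV m) (Uq q)).toLinearMap

@[simp]
theorem adMul_tmul (q : ℂˣ) (m : ℕ) (X w : EndV m) (s : Uq q) :
    adMul q m X (w ⊗ₜ s) = adV q m s X * w := rfl

/-- The linear map `w ⊗ s ↦ S(s) Ψ(S̲(w))`, where `Ψ(b) = ∑ (R₂ ▷ X) (R₁ ▷ b)` is the product of
the braiding of `b` with `X`. -/
def braidedConj (q : ℂˣ) (m : ℕ) (X : EndV m) : EndV m ⊗[ℂ] Uq q →ₗ[ℂ] EndV m :=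
  LinearMap.mul' ℂ (EndV m) ∘ₗ
    TensorProduct.map ((rep q m).toLinearMap ∘ₗ antipode q)
      (adMul q m X ∘ₗ coact q m ∘ₗ coactAntipode q m) ∘ₗ
    (TensorProduct.comm ℂ (EndV m) (Uq q)).toLinearMap

@[simp]
theorem braidedConj_tmul (q : ℂˣ) (m : ℕ) (X w : EndV m) (s : Uq q) :
    braidedConj q m X (w ⊗ₜ s) = rep q m (antipode q s) *
      adMul q m X (coact q m (coactAntipode q m w)) := rfl

/-- The braiding and the braided antipode combine to the ordinary antipode:
`∑ S(R₂) (R₂' ▷ X) (R₁' ▷ S̲(R₁ ▷ A)) = X S(A)`. -/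
theorem braidedConj_coact {q : ℂˣ} (hq : ∀ n : ℕ, 0 < n → q ^ n ≠ 1) {m : ℕ} (X A : EndV m) :
    braidedConj q m X (coact q m A) = X * antipodeV q m A := by
  -- the linear map `w ⊗ (s ⊗ x) ↦ S(s) (x ▷ X) S̲(w)`
  let Φ : EndV m ⊗[ℂ] (Uq q ⊗[ℂ] Uq q) →ₗ[ℂ] EndV m :=
    LinearMap.mul' ℂ (EndV m) ∘ₗ
      TensorProduct.map ((antipodeAd q m).flip X) (coactAntipode q m) ∘ₗ
      (TensorProduct.comm ℂ (EndV m) (Uq q ⊗[ℂ] Uq q)).toLinearMap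
  have hΦ (w : EndV m) (z : Uq q ⊗[ℂ] Uq q) : Φ (w ⊗ₜ z)
      = antipodeAd q m z X * coactAntipode q m w := rfl
  have h1 (z : EndV m ⊗[ℂ] Uq q) :
      Φ (swapRight q m (TensorProduct.map (coact q m) LinearMap.id z)) = braidedConj q m X z := by
    induction z with
    | zero => simp
    | add a b ha hb => simp only [map_add, ha, hb]
    | tmul w s =>
      have h (y : EndV m ⊗[ℂ] Uq q) : Φ (swapRight q m (y ⊗ₜ s)) = rep q m (antipode q s) *
          adMul q m X (TensorProduct.map (coactAntipode q m) LinearMap.id y) := by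
        induction y with
        | zero => simp
        | add a b ha hb => simp only [TensorProduct.add_tmul, map_add, ha, hb, mul_add]
        | tmul v x =>
          rw [swapRight_tmul, hΦ, antipodeAd_tmul, TensorProduct.map_tmul, adMul_tmul, mul_assoc,
            LinearMap.id_apply]
      rw [TensorProduct.map_tmul, LinearMap.id_apply, h, ← coact_coactAntipode hq,
        braidedConj_tmul]
  have h2 (z : EndV m ⊗[ℂ] Uq q) :
      Φ (TensorProduct.map LinearMap.id (comul q).toLinearMap z) =
        X * LinearMap.mul' ℂ (EndV m) (TensorProduct.comm ℂ (EndV m) (EndV m)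
          (TensorProduct.map (coactAntipode q m) ((rep q m).toLinearMap ∘ₗ antipode q) z)) := by
    induction z with
    | zero => simp
    | add a b ha hb => simp only [map_add, ha, hb, mul_add]
    | tmul w s =>
      rw [TensorProduct.map_tmul, LinearMap.id_apply, AlgHom.toLinearMap_apply, hΦ,
        antipodeAd_comul, mul_assoc]
      rfl
  rw [← h1, ← map_comul_coact hq, h2, sum_antipode_mul_coactAntipode hq]

/-! ### The braided adjoint action -/

theorem rMatrix_rep {q : ℂˣ} (hq : ∀ n : ℕ, 0 < n → q ^ n ≠ 1) {lnq : ℂ}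
    (hlnq : Complex.exp lnq = q) (m : ℕ) :
    rMatrix q lnq (adHV q m) (adV q m (E q)) (hV m) (rep q m (F q)) =
      Algebra.TensorProduct.map (AlgHom.id ℂ _) (rep q m) (adR q m) :=
  rMatrix_eq_map hlnq (isWeightDecomposition_adHom q m) (adV_E_pow_eq_zero hq m)
    (isWeightDecomposition_rep q m)

theorem rMatrix_adHom {q : ℂˣ} (hq : ∀ n : ℕ, 0 < n → q ^ n ≠ 1) {lnq : ℂ}
    (hlnq : Complex.exp lnq = q) (m : ℕ) :
    rMatrix q lnq (adHV q m) (adV q m (E q)) (adHV q m) (adV q m (F q)) =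
      Algebra.TensorProduct.map (AlgHom.id ℂ _) (adHom q m) (adR q m) := by
  rw [← adHom_apply q m (F q)]
  exact rMatrix_eq_map hlnq (isWeightDecomposition_adHom q m) (adV_E_pow_eq_zero hq m)
    (isWeightDecomposition_adHom q m)

theorem braidedAntipode_eq {q : ℂˣ} (hq : ∀ n : ℕ, 0 < n → q ^ n ≠ 1) {lnq : ℂ}
    (hlnq : Complex.exp lnq = q) (m : ℕ) : braidedAntipode q lnq m = coactAntipode q m := by
  refine LinearMap.ext fun A => ?_
  rw [braidedAntipode, rMatrix_rep hq hlnq, coactAntipode_apply, coact_apply]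
  induction adR q m with
  | zero => simp
  | tmul r s => rfl
  | add a b ha hb => simp only [map_add, LinearMap.add_apply, ha, hb]

theorem mul'_braiding {q : ℂˣ} (hq : ∀ n : ℕ, 0 < n → q ^ n ≠ 1) {lnq : ℂ}
    (hlnq : Complex.exp lnq = q) (m : ℕ) (A X : EndV m) :
    LinearMap.mul' ℂ (EndV m) (braiding q lnq m m (A ⊗ₜ X)) = adMul q m X (coact q m A) := by
  rw [braiding, rMatrix_adHom hq hlnq, coact_apply]
  induction adR q m with
  | zero => simp
  | tmul r s => rfl
  | add a b ha hb =>
    simp only [LinearMap.comp_apply] at ha hb ⊢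
    simp only [map_add, LinearMap.add_apply, ha, hb]

/-- The linear map `a ⊗ b ↦ a Ψ(S̲(b))`, where `Ψ(b) = ∑ (R₂ ▷ X) (R₁ ▷ b)`. -/
def mulBraidedConj (q : ℂˣ) (m : ℕ) (X : EndV m) : EndV m ⊗[ℂ] EndV m →ₗ[ℂ] EndV m :=
  LinearMap.mul' ℂ (EndV m) ∘ₗ
    TensorProduct.map LinearMap.id (adMul q m X ∘ₗ coact q m ∘ₗ coactAntipode q m)

theorem braidedAd_apply {q : ℂˣ} (hq : ∀ n : ℕ, 0 < n → q ^ n ≠ 1) {lnq : ℂ}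
    (hlnq : Complex.exp lnq = q) (u X : Uq q) (m : ℕ) :
    braidedAd q lnq u X m = mulBraidedConj q m (rep q m X) (braidedComul q lnq u m m) := by
  have h : braidedAd q lnq u X m = LinearMap.mul' ℂ (EndV m)
      (TensorProduct.map LinearMap.id (LinearMap.mul' ℂ (EndV m))
        (TensorProduct.map LinearMap.id (braiding q lnq m m)
          (TensorProduct.map LinearMap.id
            (TensorProduct.map (braidedAntipode q lnq m) LinearMap.id)
            (TensorProduct.assoc ℂ (EndV m) (EndV m) (EndV m)
              (braidedComul q lnq u m m ⊗ₜ rep q m X))))) := rfl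
  rw [h, braidedAntipode_eq hq hlnq]
  induction braidedComul q lnq u m m with
  | zero => simp
  | tmul a b =>
    rw [TensorProduct.assoc_tmul, TensorProduct.map_tmul, TensorProduct.map_tmul,
      TensorProduct.map_tmul, TensorProduct.map_tmul, LinearMap.id_apply, LinearMap.id_apply,
      LinearMap.id_apply, LinearMap.id_apply, mul'_braiding hq hlnq]
    rfl
  | add a b ha hb => simp only [TensorProduct.add_tmul, map_add, ha, hb]

theorem braidedAd_eq {q : ℂˣ} (hq : ∀ n : ℕ, 0 < n → q ^ n ≠ 1) {lnq : ℂ}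
    (hlnq : Complex.exp lnq = q) (u X : Uq q) :
    braidedAd q lnq u X = toCompl q (ad q u X) := by
  funext m
  change _ = rep q m (ad q u X)
  rw [braidedAd_apply hq hlnq, rep_ad, adV_eq_bimodAct, braidedComul, rMatrix_rep hq hlnq]
  induction comul q u with
  | zero => simp
  | add a b ha hb => simp only [map_add, LinearMap.add_apply, ha, hb]
  | tmul x y =>
    rw [bimodAct_tmul, ← braidedConj_coact hq, coact_apply]
    induction adR q m with
    | zero => simp
    | add a b ha hb => simp only [map_add, LinearMap.add_apply, ha, hb, mul_add]
    | tmul r s =>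
      have h1 : braidedConj q m (rep q m X) (TensorProduct.map (LinearMap.applyₗ (rep q m y))
          LinearMap.id (r ⊗ₜ s)) = antipodeV q m (rep q m s) * adMul q m (rep q m X)
            (coact q m (coactAntipode q m (r (rep q m y)))) := by
        rw [antipodeV_rep]; rfl
      rw [h1, ← mul_assoc]
      rfl

/-! ### Injectivity of the map to the completion -/

/-- The monomial `F^a K^b E^c`. -/
def monomial (q : ℂˣ) (p : ℕ × ℤ × ℕ) : Uq q := F q ^ p.1 * Kpow q p.2.1 * E q ^ p.2.2

/-- The monomials `F^a K^b E^c` span `U_q(sl₂)`. -/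
theorem span_monomial {q : ℂˣ} (hq : ∀ n : ℕ, 0 < n → q ^ n ≠ 1) :
    Submodule.span ℂ (Set.range (monomial q)) = ⊤ := by
  set V := Submodule.span ℂ (Set.range (monomial q)) with hV
  have mem (a : ℕ) (b : ℤ) (c : ℕ) : F q ^ a * Kpow q b * E q ^ c ∈ V :=
    Submodule.subset_span ⟨(a, b, c), rfl⟩
  have stable (x : Uq q) (h : ∀ a b c, x * (F q ^ a * Kpow q b * E q ^ c) ∈ V) (v : Uq q)
      (hv : v ∈ V) : x * v ∈ V := by
    induction hv using Submodule.span_induction with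
    | mem v hv => obtain ⟨p, rfl⟩ := hv; exact h _ _ _
    | zero => rw [mul_zero]; exact V.zero_mem
    | add v w _ _ hv hw => rw [mul_add]; exact V.add_mem hv hw
    | smul c v _ hv => rw [mul_smul_comm]; exact V.smul_mem c hv
  have hF : ∀ v ∈ V, F q * v ∈ V := stable _ fun a b c => by
    rw [← mul_assoc, ← mul_assoc, ← pow_succ']
    exact mem _ _ _
  have hK : ∀ v ∈ V, K q * v ∈ V := stable _ fun a b c => by
    rw [← mul_assoc, ← mul_assoc, K_mul_F_pow, smul_mul_assoc, smul_mul_assoc,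
      mul_assoc (F q ^ a), K_mul_Kpow]
    exact V.smul_mem _ (mem _ _ _)
  have hKinv : ∀ v ∈ V, Kinv q * v ∈ V := stable _ fun a b c => by
    have h : Kinv q * F q ^ a = (qInvSq q ^ a)⁻¹ • (F q ^ a * Kinv q) := by
      rw [F_pow_mul_Kinv, smul_smul, inv_mul_cancel₀ (pow_ne_zero _ (qInvSq_ne_zero q)), one_smul]
    rw [← mul_assoc, ← mul_assoc, h, smul_mul_assoc, smul_mul_assoc, mul_assoc (F q ^ a),
      Kinv_mul_Kpow]
    exact V.smul_mem _ (mem _ _ _)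
  have hE : ∀ v ∈ V, E q * v ∈ V := stable _ fun a b c => by
    have h (a : ℕ) : F q ^ a * E q * (Kpow q b * E q ^ c) ∈ V := by
      rw [mul_assoc, ← mul_assoc (E q), E_mul_Kpow, smul_mul_assoc, mul_smul_comm,
        mul_assoc (Kpow q b), ← pow_succ', ← mul_assoc]
      exact V.smul_mem _ (mem _ _ _)
    rw [mul_assoc, ← mul_assoc]
    cases a with
    | zero => simpa using h 0
    | succ n =>
      rw [E_mul_F_pow hq, add_mul, smul_mul_assoc, sub_mul]
      refine V.add_mem (h _) (V.smul_mem _ (V.sub_mem ?_ ?_))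
      · rw [mul_assoc, ← mul_assoc (K q), K_mul_Kpow, ← mul_assoc]
        exact mem _ _ _
      · rw [mul_assoc]
        refine hKinv _ ?_
        rw [← mul_assoc]
        exact mem _ _ _
  have key (u : Uq q) : ∀ v ∈ V, u * v ∈ V := by
    induction u using Uq.induction with
    | scalar c =>
      intro v hv
      rw [← Algebra.smul_def]
      exact V.smul_mem c hv
    | gen x => cases x <;> assumption
    | mul u w hu hw => intro v hv; rw [mul_assoc]; exact hu _ (hw _ hv)
    | add u w hu hw => intro v hv; rw [add_mul]; exact V.add_mem (hu _ hv) (hw _ hv)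
  rw [eq_top_iff]
  intro u _
  have h1 : (1 : Uq q) ∈ V := by simpa [Kpow_zero] using mem 0 0 0
  simpa using key u 1 h1

theorem rep_F_pow_apply (q : ℂˣ) (m a : ℕ) (i j : Fin (m + 1)) :
    rep q m (F q ^ a) j i = if (j : ℕ) = i + a then 1 else 0 := by
  induction a generalizing j with
  | zero => simp [Matrix.one_apply, Fin.ext_iff]
  | succ a ih =>
    rw [pow_succ', map_mul, Matrix.mul_apply]
    simp only [ih, rep_gen, repGen, Matrix.of_apply, mul_ite, mul_one, mul_zero]
    by_cases h : (j : ℕ) = i + (a + 1)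
    · rw [if_pos h, Finset.sum_eq_single (⟨i + a, by omega⟩ : Fin (m + 1))]
      · simp [h, add_assoc]
      · intro k _ hk
        have : (k : ℕ) ≠ i + a := fun e => hk (Fin.ext e)
        simp [this]
      · simp
    · rw [if_neg h, Finset.sum_eq_zero]
      intro k _
      split_ifs with h1 h2
      · omega
      · rfl
      · rfl

theorem rep_Kpow_apply (q : ℂˣ) (m : ℕ) (b : ℤ) :
    rep q m (Kpow q b) = Matrix.diagonal fun i => (q : ℂ) ^ (b * wt m i) := by
  rw [(isWeightDecomposition_rep q m).Kpow_eq]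
  ext i j
  simp [Matrix.sum_apply, Matrix.single_apply, Matrix.diagonal_apply, ite_and]

/-- The vector `E^c v_i` is a multiple of `v_{i-c}`. -/
theorem rep_E_pow_apply_eq_zero (q : ℂˣ) (m c : ℕ) (i j : Fin (m + 1)) (h : (j : ℕ) + c ≠ i) :
    rep q m (E q ^ c) j i = 0 := by
  induction c generalizing j with
  | zero =>
    have : j ≠ i := fun e => h (by simp [e])
    simp [this]
  | succ c ih =>
    rw [pow_succ', map_mul, Matrix.mul_apply]
    refine Finset.sum_eq_zero fun k _ => ?_
    simp only [rep_gen, repGen, Matrix.of_apply]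
    split_ifs with hk
    · rw [ih k (by omega), mul_zero]
    · rw [zero_mul]

/-- The vector `E^c v_c` is a nonzero multiple of `v_0`. -/
theorem rep_E_pow_apply_ne_zero {q : ℂˣ} (hq : ∀ n : ℕ, 0 < n → q ^ n ≠ 1) (m c : ℕ)
    (i j : Fin (m + 1)) (h : (j : ℕ) + c = i) : rep q m (E q ^ c) j i ≠ 0 := by
  induction c generalizing j with
  | zero =>
    have : j = i := Fin.ext h
    simp [this]
  | succ c ih =>
    rw [pow_succ', map_mul, Matrix.mul_apply,
      Finset.sum_eq_single (⟨j + 1, by omega⟩ : Fin (m + 1))]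
    · refine mul_ne_zero ?_ (ih _ (by simp only; omega))
      simp only [rep_gen, repGen, Matrix.of_apply, if_true]
      have e : m + 1 - ((j : ℕ) + 1) = m - (j + 1) + 1 := by omega
      rw [e]
      exact mul_ne_zero (qNum_succ_ne_zero hq _) (qNum_succ_ne_zero hq _)
    · intro k _ hk
      have : (j : ℕ) + 1 ≠ k := fun e => hk (Fin.ext e.symm)
      simp [rep_gen, repGen, this]
    · simp

/-- The coefficient of `v_i` in `F^a K^b E^c v_k` for `k ≤ c`: it vanishes unless `k = c` and
`i = a`. -/
theorem rep_monomial_apply (q : ℂˣ) (m : ℕ) (p : ℕ × ℤ × ℕ) (i k : Fin (m + 1))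
    (h : (k : ℕ) ≤ p.2.2) : rep q m (monomial q p) i k =
      if p.2.2 = k ∧ p.1 = i then (q : ℂ) ^ (p.2.1 * m) * rep q m (E q ^ (k : ℕ)) 0 k else 0 := by
  rw [monomial, map_mul, map_mul, rep_Kpow_apply, Matrix.mul_apply, Finset.sum_eq_single 0]
  · rw [Matrix.mul_diagonal, rep_F_pow_apply]
    by_cases h1 : p.2.2 = k
    · have h0 : wt m 0 = m := by simp [wt]
      by_cases h2 : p.1 = i
      · simp [h1, h2, h0]
      · simp [h2, Ne.symm h2]
    · rw [rep_E_pow_apply_eq_zero q m p.2.2 k 0 (by simpa using h1), mul_zero, if_neg]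
      exact fun h => h1 h.1
  · intro j _ hj
    have : (j : ℕ) ≠ 0 := fun e => hj (Fin.ext e)
    rw [rep_E_pow_apply_eq_zero q m p.2.2 k j (by omega), mul_zero]
  · simp

/-- Distinct exponential functions `n ↦ q ^ (b n)` are linearly independent, also on a half line. -/
theorem coeff_eq_zero_of_sum_zpow {q : ℂˣ} (hq : ∀ n : ℕ, 0 < n → q ^ n ≠ 1) (s : Finset ℤ)
    (x : ℤ → ℂ) (m₀ : ℕ) (h : ∀ m : ℕ, m₀ ≤ m → ∑ b ∈ s, x b * (q : ℂ) ^ (b * m) = 0) (b : ℤ)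
    (hb : b ∈ s) : x b = 0 := by
  let χ (b : ℤ) : Multiplicative ℕ →* ℂ := powersHom ℂ ((q : ℂ) ^ b)
  have hχ : Function.Injective χ := fun b b' h => by
    have := DFunLike.congr_fun h (Multiplicative.ofAdd 1)
    simp only [χ, powersHom_apply, toAdd_ofAdd, pow_one] at this
    exact zpow_injective hq this
  have hli := (linearIndependent_monoidHom (Multiplicative ℕ) ℂ).comp χ hχ
  have h0 := linearIndependent_iff'.mp hli s (fun b => x b * (q : ℂ) ^ (b * m₀)) (by
    funext n
    rw [Finset.sum_apply, Pi.zero_apply, ← h (m₀ + n.toAdd) (by omega)]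
    refine Finset.sum_congr rfl fun b _ => ?_
    simp only [Function.comp_apply, Pi.smul_apply, χ, powersHom_apply, smul_eq_mul]
    push_cast
    rw [mul_add, zpow_add₀ q.ne_zero, zpow_mul _ b (n.toAdd : ℤ), zpow_natCast, mul_assoc]) b hb
  exact (mul_eq_zero.mp h0).resolve_right (zpow_ne_zero _ q.ne_zero)

/-- The finite-dimensional representations of type 1 separate the elements of `U_q(sl₂)`. -/
theorem toCompl_injective {q : ℂˣ} (hq : ∀ n : ℕ, 0 < n → q ^ n ≠ 1) :
    Function.Injective (toCompl q) := by
  rw [injective_iff_map_eq_zero]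
  intro u hu
  have hu' : u ∈ Submodule.span ℂ (Set.range (monomial q)) := by
    rw [span_monomial hq]; trivial
  obtain ⟨x, rfl⟩ := Finsupp.mem_span_range_iff_exists_finsupp.mp hu'
  suffices h : ∀ c a b, x (a, b, c) = 0 by
    have : x = 0 := Finsupp.ext fun p => h _ _ _
    rw [this, Finsupp.sum_zero_index]
  intro c
  induction c using Nat.strong_induction_on with
  | _ c ih =>
  intro a b
  by_contra hne
  -- the entry at `(a, c)` only sees the coefficients of the monomials `F^a K^b E^c`
  have hm (m : ℕ) (hm : a + c ≤ m) :
      ∑ b' ∈ x.support.image fun p => p.2.1, x (a, b', c) * (q : ℂ) ^ (b' * m) = 0 := by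
    have h0 := congrFun (congrFun (congrFun hu m) ⟨a, by omega⟩) ⟨c, by omega⟩
    have h1 : toCompl q (x.sum fun i a => a • monomial q i) m
        = ∑ p ∈ x.support, x p • rep q m (monomial q p) := by
      change rep q m _ = _
      rw [Finsupp.sum, map_sum]
      simp only [map_smul]
    rw [h1, Matrix.sum_apply] at h0
    have hE := rep_E_pow_apply_ne_zero hq m c ⟨c, by omega⟩ 0 (by simp)
    refine (mul_eq_zero.mp (?_ : _ * rep q m (E q ^ c) 0 ⟨c, by omega⟩ = 0)).resolve_right hE
    have h2 : ∀ p ∈ x.support, (x p • rep q m (monomial q p)) ⟨a, by omega⟩ ⟨c, by omega⟩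
        = if p = (a, p.2.1, c) then x (a, p.2.1, c) * (q : ℂ) ^ (p.2.1 * m) *
          rep q m (E q ^ c) 0 ⟨c, by omega⟩ else 0 := by
      rintro ⟨a', b', c'⟩ hp
      have hc : c ≤ c' := by
        by_contra hlt
        exact Finsupp.mem_support_iff.mp hp (ih c' (by omega) a' b')
      rw [Matrix.smul_apply, rep_monomial_apply q m _ _ _ hc, smul_eq_mul]
      by_cases h : c' = c ∧ a' = a
      · obtain ⟨rfl, rfl⟩ := h
        simp [mul_assoc]
      · have h' : ¬ (a' = a ∧ c' = c) := fun h' => h h'.symm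
        simp [h, h']
    rw [Finset.sum_congr rfl h2, ← Finset.sum_filter] at h0
    rw [Finset.sum_mul]
    refine Eq.trans (Eq.symm (Finset.sum_of_injOn (fun p : ℕ × ℤ × ℕ => p.2.1) ?_ ?_ ?_
      fun p _ => rfl)) h0
    · intro p hp r hr hpr
      rw [(Finset.mem_filter.mp hp).2, (Finset.mem_filter.mp hr).2]
      simp only at hpr
      rw [hpr]
    · intro p hp
      exact Finset.mem_image_of_mem _ (Finset.mem_filter.mp hp).1
    · intro b' _ hb'
      have : x (a, b', c) = 0 := by
        by_contra h
        exact hb' ⟨(a, b', c), Finset.mem_filter.mpr ⟨Finsupp.mem_support_iff.mpr h, rfl⟩, rfl⟩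
      rw [this, zero_mul, zero_mul]
  refine hne (coeff_eq_zero_of_sum_zpow hq _ (fun b' => x (a, b', c)) (a + c) hm b ?_)
  exact Finset.mem_image.mpr ⟨(a, b, c), Finsupp.mem_support_iff.mpr hne, rfl⟩

end

end QuantumSL2

theorem proposition5p1 (q : ℂˣ) (hq : ∀ n : ℕ, 0 < n → q ^ n ≠ 1)
    (lnq : ℂ) (hlnq : Complex.exp lnq = q) :
    Function.Injective (QuantumSL2.toCompl q) ∧
    (∀ u X : QuantumSL2.Uq q,
      QuantumSL2.braidedAd q lnq u X = QuantumSL2.toCompl q (QuantumSL2.ad q u X)) ∧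
    (∀ X : QuantumSL2.Uq q,
      QuantumSL2.braidedAd q lnq (QuantumSL2.E q) X = QuantumSL2.toCompl q
        ((QuantumSL2.E q * X - X * QuantumSL2.E q) * QuantumSL2.Kinv q) ∧
      QuantumSL2.braidedAd q lnq (QuantumSL2.K q) X = QuantumSL2.toCompl q
        (QuantumSL2.K q * X * QuantumSL2.Kinv q) ∧
      QuantumSL2.braidedAd q lnq (QuantumSL2.Kinv q) X = QuantumSL2.toCompl q
        (QuantumSL2.Kinv q * X * QuantumSL2.K q) ∧
      QuantumSL2.braidedAd q lnq (QuantumSL2.F q) X = QuantumSL2.toCompl q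
        (QuantumSL2.F q * X - QuantumSL2.Kinv q * X * QuantumSL2.K q * QuantumSL2.F q)) := by
  refine ⟨QuantumSL2.toCompl_injective hq, QuantumSL2.braidedAd_eq hq hlnq, fun X =>
    ⟨?_, ?_, ?_, ?_⟩⟩ <;>
  · rw [QuantumSL2.braidedAd_eq hq hlnq]
    funext m
    change QuantumSL2.rep q m _ = QuantumSL2.rep q m _
    rw [QuantumSL2.rep_ad]
    simp only [QuantumSL2.adV_E, QuantumSL2.adV_K, QuantumSL2.adV_Kinv, QuantumSL2.adV_F,
      map_mul, map_sub]
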